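/- **Definitions.** Let $p,d\ge 1$ be integers. For a tensor $T\in(\mathbb C^d)^{\otimes p}$ let $$\|T\|_{\mathrm{inj}}=\max_{x_1,\dots,x_p\in\mathbb C^d,\ \|x_i\|_2=1}\Big|\sum_{i_1,\dots,i_p=1}^d\overline{T_{i_1,\dots,i_p}}\,(x_1)_{i_1}\cdots(x_p)_{i_p}\Big|.$$ A complex random variable $Y$ with finite moments is *rigidly sub-Gaussian* if $Y$ and $e^{i\theta}Y$ have the same law for every $\theta\in\mathbb R$, and $\mathbb E|Y|^{2k}\le k!\,(\mathbb E|Y|^2)^k$ for every integer $k\ge 0$. *Model $S_{\mathbb C}$* (for given $p,d$): a random symmetric tensor $B\in\mathrm{Sym}_p(\mathbb C^d)$ whose entries are independent up to symmetry (that is, the entries $B_{i_1,\dots,i_p}$ with $i_1\le\dots\le i_p$ are jointly independent) and such that, for some rigidly sub-Gaussian $\gamma$ with $\mathbb E|\gamma|^2=1/d$, every entry $B_{i_1,\dots,i_p}$ has the law of $\sqrt{|\mathrm{Stab}(i_1,\dots,i_p)|/p!}\;\gamma$, where $\mathrm{Stab}(i_1,\dots,i_p)\subseteq\mathfrak S_p$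 is the stabilizer of the tuple. *Model $\widetilde S_{\mathbb C}$* (for given $p,d$): $B=\frac1{p!}\sum_{\sigma\in\mathfrak S_p}\sigma(T)$, where $T\in(\mathbb C^d)^{\otimes p}$ has i.i.d. rigidly sub-Gaussian entries with $\mathbb E|T_{1,\dots,1}|^2=1/d$ and $\mathfrak S_p$ permutes the tensor factors. For $\alpha>0$ put $$\phi_p(\alpha)=\frac{1}{p^{p/2}\sqrt e}\,\alpha^{-\frac12(\alpha+1)}(p+\alpha)^{\frac12(p+\alpha)}.$$ **Theorem.** For all $p,d\ge 1$, if $B$ comes from Model $S_{\mathbb C}$ or Model $\widetilde S_{\mathbb C}$, then $\|B\|_{\mathrm{inj}}$ is integrable. Moreover, the following hold. 1. ($d$ fixed, $p\to\infty$.) Let $d\ge1$, and for each $p\ge1$ let $B=B^{(p)}$ come from either model with parameters $p,d$. Then $$\limsup_{p\to\infty}\frac1{\sqrt{\log p}}\,\mathbb E\|B\|_{\mathrm{inj}}\le\sqrt{\frac{d-1}d}.$$ More precisely, if $d\ge2$, then for every $\epsilon>0$ there is $p_0$, depending only on $d$ and $\epsilon$, such that for all $p\ge p_0$ and every $B$ from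 either model with parameters $p,d$, $$\frac1{\sqrt{\log p}}\,\mathbb E\|B\|_{\mathrm{inj}}\le\sqrt{\frac{d-1}d}\left(1+(1+\epsilon)\cdot\frac{2d-1}{4d-4}\cdot\frac{\log\log p}{\log p}\right).$$ 2. ($p$ fixed, $d\to\infty$.) Let $p\ge1$, and for each $d\ge1$ let $B=B^{(d)}$ come from either model with parameters $p,d$. Then $$\limsup_{d\to\infty}\mathbb E\|B\|_{\mathrm{inj}}\le\inf_{\alpha>0}\phi_p(\alpha).$$ For $p\ge2$ the infimum is attained at a unique point $\alpha_0^S(p)>0$, and $\phi_p(\alpha_0^S(p))\le\sqrt{\log p}\,(1+o(1))$ as $p\to\infty$. -/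

import Mathlib

open MeasureTheory ProbabilityTheory Filter Topology
open scoped ComplexConjugate

noncomputable section

namespace SymTensor

/-- Tensors in `(ℂ^d)^{⊗ p}`, given by their coordinates `T_{i₁,…,i_p}`. -/
abbrev Tensor (p d : ℕ) : Type := (Fin p → Fin d) → ℂ

/-- The Hermitian pairing `⟨T, x₁ ⊗ ⋯ ⊗ x_p⟩`, conjugate-linear in `T`. -/
def pairing {p d : ℕ} (T : Tensor p d) (x : Fin p → EuclideanSpace ℂ (Fin d)) : ℂ :=
  ∑ I : Fin p → Fin d, conj (T I) * ∏ k, x k (I k)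

/-- The (complex) injective norm: the supremum (a maximum, by compactness, as soon as `1 ≤ d`)
of `|⟨T, x₁ ⊗ ⋯ ⊗ x_p⟩|` over Euclidean unit vectors `x₁, …, x_p` of `ℂ^d`. -/
def injNorm {p d : ℕ} (T : Tensor p d) : ℝ :=
  sSup {r : ℝ | ∃ x : Fin p → EuclideanSpace ℂ (Fin d), (∀ k, ‖x k‖ = 1) ∧ r = ‖pairing T x‖}

/-- `T` lies in the symmetric subspace `Sym_p(ℂ^d)`. -/
def IsSymm {p d : ℕ} (T : Tensor p d) : Prop :=
  ∀ (σ : Equiv.Perm (Fin p)) (I : Fin p → Fin d), T (I ∘ σ) = T I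

/-- The projection on the symmetric subspace: the average over all permutations of the
tensor factors. -/
def symProj {p d : ℕ} (T : Tensor p d) : Tensor p d :=
  fun I => (1 / (p.factorial : ℂ)) * ∑ σ : Equiv.Perm (Fin p), T (I ∘ σ)

/-- `|Stab(i₁,…,i_p)|`, the number of permutations of the `p` positions that fix the tuple. -/
def stabCard {p d : ℕ} (I : Fin p → Fin d) : ℕ :=
  Nat.card {σ : Equiv.Perm (Fin p) // I ∘ σ = I}

/-- `ℂ`-rigidly sub-Gaussian random variables: circularly symmetric, with all even moments of
the modulus finite and dominated by those of a circularly symmetric complex Gaussian of the same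
variance. -/
structure IsRigidlySubGaussian {Ω : Type*} [MeasurableSpace Ω] (Y : Ω → ℂ) (μ : Measure Ω) :
    Prop where
  circular : ∀ θ : ℝ, IdentDistrib Y (fun ω => Complex.exp (θ * Complex.I) * Y ω) μ μ
  integrable_pow : ∀ k : ℕ, Integrable (fun ω => ‖Y ω‖ ^ (2 * k)) μ
  moment_le : ∀ k : ℕ,
    ∫ ω, ‖Y ω‖ ^ (2 * k) ∂μ ≤ (k.factorial : ℝ) * (∫ ω, ‖Y ω‖ ^ 2 ∂μ) ^ k

/-- Model `A_ℂ` with equal dimensions `d₁ = ⋯ = d_p = d`: i.i.d. `ℂ`-rigidly sub-Gaussian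
entries of variance `1 / (d₁ ⋯ d_p)^{1/p} = 1 / d`. -/
structure ModelA {p d : ℕ} {Ω : Type*} [MeasurableSpace Ω] (T : Ω → Tensor p d)
    (μ : Measure Ω) : Prop where
  indep : iIndepFun (fun (I : Fin p → Fin d) (ω : Ω) => T ω I) μ
  identDistrib : ∀ I J : Fin p → Fin d, IdentDistrib (fun ω => T ω I) (fun ω => T ω J) μ μ
  rigid : ∀ I : Fin p → Fin d, IsRigidlySubGaussian (fun ω => T ω I) μ
  variance : ∀ I : Fin p → Fin d, ∫ ω, ‖T ω I‖ ^ 2 ∂μ = 1 / (d : ℝ)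

/-- Model `S_ℂ`. The variable `γ` enters only through its law `ν` on `ℂ`. The nondecreasing
multi-indices form a system of representatives of the multi-indices up to permutation. -/
def ModelS {p d : ℕ} {Ω : Type*} [MeasurableSpace Ω] (B : Ω → Tensor p d)
    (μ : Measure Ω) : Prop :=
  (∀ᵐ ω ∂μ, IsSymm (B ω)) ∧
  iIndepFun (fun (I : {I : Fin p → Fin d // Monotone I}) (ω : Ω) => B ω I.1) μ ∧
  ∃ ν : Measure ℂ, IsProbabilityMeasure ν ∧ IsRigidlySubGaussian (fun z : ℂ => z) ν ∧
    ∫ z, ‖z‖ ^ 2 ∂ν = 1 / (d : ℝ) ∧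
    ∀ I : Fin p → Fin d, IdentDistrib (fun ω => B ω I)
      (fun z : ℂ => ((√((stabCard I : ℝ) / (p.factorial : ℝ)) : ℝ) : ℂ) * z) μ ν

/-- Model `S̃_ℂ`: the symmetrization of a random tensor of Model `A_ℂ`. -/
def ModelSTilde {p d : ℕ} {Ω : Type*} [MeasurableSpace Ω] (B : Ω → Tensor p d)
    (μ : Measure Ω) : Prop :=
  ∃ T : Ω → Tensor p d, ModelA T μ ∧ ∀ᵐ ω ∂μ, B ω = symProj (T ω)

/-- `φ_p(α) = p^{-p/2} e^{-1/2} α^{-(α+1)/2} (p+α)^{(p+α)/2}`, meant for `α > 0`. -/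
def phi (p : ℕ) (α : ℝ) : ℝ :=
  1 / ((p : ℝ) ^ ((p : ℝ) / 2) * √(Real.exp 1)) *
    α ^ (-(1 / 2 : ℝ) * (α + 1)) * ((p : ℝ) + α) ^ ((1 / 2 : ℝ) * ((p : ℝ) + α))

end SymTensor

end

/-! Everything rests on one moment estimate: for every `k`, `(𝔼‖B‖_inj)^(2k) ≤ C(pk+d-1, d-1) · k! /
d^k` (`HasDiagonalMoments.integral_injNorm_pow_le`).

By Banach's theorem (`IsSymm.exists_injNorm_eq`) the injective norm of a symmetric tensor `B` is the
maximum over the unit sphere of the modulus of the homogeneous polynomial `f(x) = ⟨B, x^{⊗p}⟩`. The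
power `f^k` is homogeneous of degree `pk`, and Cauchy–Schwarz in the monomial basis, orthogonal for
the standard complex Gaussian `g`, gives `(pk)! |f(x)|^(2k) ≤ 𝔼_g |f(g)|^(2k)` for unit `x`
(`norm_sq_eval_le`). Exchange the expectations over `B` and `g`. For fixed `g`, `⟨B, g^{⊗p}⟩` is a
linear combination of conjugates of independent rigidly sub-Gaussian variables, hence itself rigidly
sub-Gaussian, with variance `‖g‖^(2p)/d` in both models. Its `2k`-th moment is therefore at most `k!
‖g‖^(2pk)/d^k`, and `𝔼_g ‖g‖^(2pk) = (pk)! C(pk+d-1, d-1)`. Jensen's inequality then passes to the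
first moment.

What remains is the choice of `k`. For fixed `d ≥ 2`, `k = ⌈(d-1) log p⌉` balances the binomial
against `k!`. For fixed `p`, `k = ⌈d/α⌉` makes the `2k`-th root of the bound tend to `φ_p(α)`. The
minimiser of `φ_p` is found by calculus in the variable `u = 1/α`. -/

noncomputable section

namespace SymTensor

/-! ### The injective norm and Banach's theorem on symmetric tensors. -/

section

variable {p d : ℕ}

/-- The pairing with a fixed tensor, as a multilinear map. -/
def pairingMultilinear (T : Tensor p d) :
    MultilinearMap ℂ (fun _ : Fin p => EuclideanSpace ℂ (Fin d)) ℂ :=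
  ∑ I : Fin p → Fin d, conj (T I) • (MultilinearMap.mkPiAlgebra ℂ (Fin p) ℂ).compLinearMap
    (fun k => (EuclideanSpace.proj (I k) : EuclideanSpace ℂ (Fin d) →L[ℂ] ℂ).toLinearMap)

theorem pairingMultilinear_apply (T : Tensor p d) (x : Fin p → EuclideanSpace ℂ (Fin d)) :
    pairingMultilinear T x = pairing T x := by
  simp [pairingMultilinear, pairing]

theorem continuous_pairing (T : Tensor p d) : Continuous (pairing T) := by
  unfold pairing
  fun_prop

theorem norm_coord_le_one {x : EuclideanSpace ℂ (Fin d)} (hx : ‖x‖ = 1) (i : Fin d) :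
    ‖x i‖ ≤ 1 := hx ▸ PiLp.norm_apply_le x i

theorem norm_pairing_le_sum (T : Tensor p d) {x : Fin p → EuclideanSpace ℂ (Fin d)}
    (hx : ∀ k, ‖x k‖ = 1) : ‖pairing T x‖ ≤ ∑ I, ‖T I‖ := by
  refine (norm_sum_le _ _).trans (Finset.sum_le_sum fun I _ => ?_)
  rw [norm_mul, norm_prod, RCLike.norm_conj]
  exact mul_le_of_le_one_right (norm_nonneg _)
    (Finset.prod_le_one (fun _ _ => norm_nonneg _) fun k _ => norm_coord_le_one (hx k) _)

theorem bddAbove_injNorm_set (T : Tensor p d) :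
    BddAbove {r : ℝ | ∃ x : Fin p → EuclideanSpace ℂ (Fin d), (∀ k, ‖x k‖ = 1) ∧
      r = ‖pairing T x‖} := by
  refine ⟨∑ I, ‖T I‖, ?_⟩
  rintro r ⟨x, hx, rfl⟩
  exact norm_pairing_le_sum T hx

/-- Keeps the set defining `injNorm` nonempty. For `d = 0` and `p ≥ 1` that set is empty and `sSup`
takes its default value `0`. -/
theorem exists_unit_tuple (hd : 1 ≤ d) :
    ∃ x : Fin p → EuclideanSpace ℂ (Fin d), ∀ k, ‖x k‖ = 1 :=
  ⟨fun _ => EuclideanSpace.single ⟨0, hd⟩ 1, fun k => by simp⟩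

theorem norm_pairing_le_injNorm (T : Tensor p d) {x : Fin p → EuclideanSpace ℂ (Fin d)}
    (hx : ∀ k, ‖x k‖ = 1) : ‖pairing T x‖ ≤ injNorm T :=
  le_csSup (bddAbove_injNorm_set T) ⟨x, hx, rfl⟩

theorem injNorm_le (hd : 1 ≤ d) (T : Tensor p d) {M : ℝ}
    (h : ∀ x : Fin p → EuclideanSpace ℂ (Fin d), (∀ k, ‖x k‖ = 1) → ‖pairing T x‖ ≤ M) :
    injNorm T ≤ M := by
  obtain ⟨x, hx⟩ := exists_unit_tuple (p := p) hd
  refine csSup_le ⟨_, x, hx, rfl⟩ ?_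
  rintro r ⟨y, hy, rfl⟩
  exact h y hy

theorem injNorm_nonneg (T : Tensor p d) : 0 ≤ injNorm T := by
  refine Real.sSup_nonneg ?_
  rintro r ⟨x, -, rfl⟩
  exact norm_nonneg _

theorem pairing_sub (T S : Tensor p d) (x : Fin p → EuclideanSpace ℂ (Fin d)) :
    pairing (T - S) x = pairing T x - pairing S x := by
  simp [pairing, sub_mul]

theorem injNorm_le_sum (hd : 1 ≤ d) (T : Tensor p d) : injNorm T ≤ ∑ I, ‖T I‖ :=
  injNorm_le hd T fun _ hx => norm_pairing_le_sum T hx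

theorem injNorm_sub_le (hd : 1 ≤ d) (T S : Tensor p d) :
    injNorm T - injNorm S ≤ ∑ I, ‖T I - S I‖ := by
  rw [sub_le_iff_le_add]
  refine injNorm_le hd T fun x hx => ?_
  have h1 := norm_pairing_le_sum (T - S) hx
  have h2 := norm_pairing_le_injNorm S hx
  have h3 : pairing T x = pairing (T - S) x + pairing S x := by rw [pairing_sub]; ring
  rw [h3]
  exact (norm_add_le _ _).trans (add_le_add h1 h2)

/-- The norm is 1-Lipschitz for the `ℓ¹` distance of the entries. This supplies the measurability of
`ω ↦ injNorm (B ω)`. -/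
theorem continuous_injNorm (hd : 1 ≤ d) : Continuous (injNorm : Tensor p d → ℝ) := by
  rw [continuous_iff_continuousAt]
  intro T
  rw [ContinuousAt, tendsto_iff_norm_sub_tendsto_zero]
  have hc : Tendsto (fun S : Tensor p d => ∑ I, ‖S I - T I‖) (𝓝 T) (𝓝 0) := by
    have : Continuous (fun S : Tensor p d => ∑ I, ‖S I - T I‖) := by fun_prop
    simpa using this.tendsto T
  refine squeeze_zero (fun _ => norm_nonneg _) (fun S => ?_) hc
  rw [Real.norm_eq_abs, abs_sub_le_iff]
  refine ⟨injNorm_sub_le hd S T, ?_⟩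
  simpa [norm_sub_rev] using injNorm_sub_le hd T S

theorem norm_pairing_le (T : Tensor p d) (x : Fin p → EuclideanSpace ℂ (Fin d)) :
    ‖pairing T x‖ ≤ injNorm T * ∏ k, ‖x k‖ := by
  by_cases h : ∃ k, x k = 0
  · obtain ⟨k, hk⟩ := h
    rw [← pairingMultilinear_apply, MultilinearMap.map_coord_zero _ k hk, norm_zero]
    exact mul_nonneg (injNorm_nonneg T) (Finset.prod_nonneg fun _ _ => norm_nonneg _)
  · push Not at h
    have hx : x = fun k => (‖x k‖ : ℂ) • ((‖x k‖ : ℂ)⁻¹ • x k) := by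
      funext k
      rw [smul_smul, mul_inv_cancel₀ (by simpa using h k), one_smul]
    have hu : ∀ k, ‖(‖x k‖ : ℂ)⁻¹ • x k‖ = 1 := fun k => by
      rw [norm_smul, norm_inv, Complex.norm_real, norm_norm,
        inv_mul_cancel₀ (norm_ne_zero_iff.2 (h k))]
    conv_lhs => rw [hx]
    rw [← pairingMultilinear_apply, MultilinearMap.map_smul_univ, pairingMultilinear_apply,
      norm_smul, norm_prod, mul_comm]
    simp only [Complex.norm_real, norm_norm]
    exact mul_le_mul_of_nonneg_right (norm_pairing_le_injNorm T hu)
      (Finset.prod_nonneg fun _ _ => norm_nonneg _)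

theorem IsSymm.pairing_comp {T : Tensor p d} (hT : IsSymm T) (σ : Equiv.Perm (Fin p))
    (x : Fin p → EuclideanSpace ℂ (Fin d)) : pairing T (x ∘ σ) = pairing T x := by
  unfold pairing
  refine Fintype.sum_equiv (σ.symm.arrowCongr (Equiv.refl (Fin d))).symm _ _ fun I => ?_
  have hI : ((σ.symm.arrowCongr (Equiv.refl (Fin d))).symm I) = I ∘ σ.symm := by
    ext; simp [Equiv.arrowCongr]
  rw [hI, hT σ.symm I]
  congr 1
  exact Fintype.prod_equiv σ _ _ fun k => by simp

/-- If a symmetric bilinear form of norm `M` attains its norm at the unit vectors `y`, `z`, then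
it also attains its norm on the diagonal at `y + z`. -/
theorem norm_bilin_add_self_eq {E : Type*} [NormedAddCommGroup E] [InnerProductSpace ℂ E]
    {b : E → E → ℂ} {M : ℝ} (hadd : ∀ u v w, b (u + v) w = b u w + b v w)
    (hneg : ∀ u w, b (-u) w = -b u w)
    (hsymm : ∀ u v, b u v = b v u) (hb : ∀ u v, ‖b u v‖ ≤ M * (‖u‖ * ‖v‖)) {y z : E}
    (hy : ‖y‖ = 1) (hz : ‖z‖ = 1) (hyz : ‖b y z‖ = M) :
    ‖b (y + z) (y + z)‖ = M * (‖y + z‖ * ‖y + z‖) := by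
  refine le_antisymm (hb _ _) ?_
  -- Polarisation: the two diagonal values must add up to at least `4M`, while by the parallelogram
  -- law their upper bounds add up to exactly `4M`, so both bounds are attained.
  have h1 : 4 * b y z = b (y + z) (y + z) - b (y - z) (y - z) := by
    have hadd' : ∀ u v w, b w (u + v) = b w u + b w v := fun u v w => by
      rw [hsymm, hadd, hsymm u, hsymm v]
    have hneg' : ∀ u w, b w (-u) = -b w u := fun u w => by rw [hsymm, hneg, hsymm u]
    simp only [sub_eq_add_neg, hadd, hadd', hneg, hneg', hsymm z y]
    ring
  have h2 : 4 * M ≤ ‖b (y + z) (y + z)‖ + ‖b (y - z) (y - z)‖ := by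
    rw [← hyz]
    calc 4 * ‖b y z‖ = ‖4 * b y z‖ := by simp
      _ ≤ _ := by rw [h1]; exact norm_sub_le _ _
  have h3 := hb (y - z) (y - z)
  have h4 := parallelogram_law_with_norm ℂ y z
  rw [hy, hz] at h4
  have h5 : M * (‖y + z‖ * ‖y + z‖) = 4 * M - M * (‖y - z‖ * ‖y - z‖) := by
    linear_combination M * h4
  linarith

theorem sum_update_update {E : Type*} [AddCommGroup E] {i j : Fin p} (hij : i ≠ j)
    (x : Fin p → E) (v w : E) :
    ∑ k, Function.update (Function.update x i v) j w k = ∑ k, x k - (x i + x j) + (v + w) := by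
  have h : ∀ (y : Fin p → E) (l : Fin p) (u : E),
      ∑ k, Function.update y l u k = ∑ k, y k - y l + u := fun y l u => by
    rw [Finset.sum_update_of_mem (Finset.mem_univ l), ← Finset.add_sum_erase _ y (Finset.mem_univ l),
      Finset.sdiff_singleton_eq_erase]
    abel
  rw [h, h, Function.update_of_ne hij.symm]
  abel

/-- Freezing every slot except `i` and `j` of a maximiser leaves a symmetric bilinear form whose
norm is attained at `(x i, x j)`. -/
theorem IsSymm.norm_pairing_add {T : Tensor p d} (hT : IsSymm T)
    {x : Fin p → EuclideanSpace ℂ (Fin d)} (hx : ∀ k, ‖x k‖ = 1)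
    (hmax : ‖pairing T x‖ = injNorm T) {i j : Fin p} (hij : i ≠ j) :
    ‖pairing T (Function.update (Function.update x i (x i + x j)) j (x i + x j))‖ =
      injNorm T * (‖x i + x j‖ * ‖x i + x j‖) := by
  set b : EuclideanSpace ℂ (Fin d) → EuclideanSpace ℂ (Fin d) → ℂ := fun u v =>
    pairing T (Function.update (Function.update x i u) j v) with hbdef
  have hb' : ∀ u v, b u v = pairingMultilinear T (Function.update (Function.update x j v) i u) :=
    fun u v => by
      simp only [hbdef]
      rw [pairingMultilinear_apply, Function.update_comm hij]
  refine norm_bilin_add_self_eq (b := b) (M := injNorm T) ?_ ?_ ?_ ?_ (hx i) (hx j) ?_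
  · intro u v w
    rw [hb', hb', hb', MultilinearMap.map_update_add]
  · intro u w
    rw [hb', hb', MultilinearMap.map_update_neg]
  · intro u v
    simp only [hbdef]
    rw [← hT.pairing_comp (Equiv.swap i j)]
    congr 1
    funext k
    simp only [Function.comp, Function.update_apply]
    rcases eq_or_ne k i with rfl | hki
    · simp [hij]
    rcases eq_or_ne k j with rfl | hkj
    · simp [hij]
    · simp [Equiv.swap_apply_of_ne_of_ne hki hkj, hki, hkj]
  · intro u v
    refine (norm_pairing_le T _).trans_eq ?_
    congr 1
    rw [Finset.prod_eq_mul i j hij]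
    · simp [hij]
    · intro k _ hk
      simp [hk.1, hk.2, hx]
    · simp
    · simp
  · simp [hbdef, hmax]

/-- Banach's theorem: the injective norm of a symmetric tensor is attained on the diagonal. -/
theorem IsSymm.exists_injNorm_eq (hp : 1 ≤ p) (hd : 1 ≤ d) {T : Tensor p d} (hT : IsSymm T) :
    ∃ x : EuclideanSpace ℂ (Fin d), ‖x‖ = 1 ∧ injNorm T = ‖pairing T fun _ => x‖ := by
  let U : Set (Fin p → EuclideanSpace ℂ (Fin d)) := Set.univ.pi fun _ => Metric.sphere 0 1
  have hU : IsCompact U := isCompact_univ_pi fun _ => isCompact_sphere _ _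
  have memU : ∀ x, x ∈ U ↔ ∀ k, ‖x k‖ = 1 := fun x => by simp [U]
  obtain ⟨x₁, hx₁⟩ := exists_unit_tuple (p := p) hd
  obtain ⟨x₂, hx₂, hmax₂⟩ := hU.exists_isMaxOn ⟨x₁, (memU _).2 hx₁⟩
    (continuous_pairing T).norm.continuousOn
  have hM : ‖pairing T x₂‖ = injNorm T :=
    le_antisymm (norm_pairing_le_injNorm T ((memU _).1 hx₂))
      (injNorm_le hd T fun y hy => hmax₂ ((memU _).2 hy))
  have hK : IsCompact (U ∩ {x | ‖pairing T x‖ = injNorm T}) :=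
    hU.inter_right (isClosed_eq (continuous_pairing T).norm continuous_const)
  -- Among all maximising tuples, take one for which `‖∑ k, x k‖` is largest. This forces the
  -- vectors to agree up to sign: otherwise one of two moves between maximisers would lengthen the
  -- sum.
  obtain ⟨x, ⟨hxU, hxM⟩, hxmax⟩ := hK.exists_isMaxOn ⟨x₂, hx₂, hM⟩
    (f := fun x => ‖∑ k, x k‖) (by fun_prop)
  have hx := (memU _).1 hxU
  have hxM : ‖pairing T x‖ = injNorm T := hxM
  have key : ∀ i j, x j = x i ∨ x j = -x i := by
    intro i j
    by_contra! hne
    have hij : i ≠ j := fun h => hne.1 (by rw [h])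
    set u := x i + x j with hu
    set s := ∑ k, x k with hs
    have hu0 : u ≠ 0 := fun h => hne.2 (eq_neg_of_add_eq_zero_right h)
    have hupos : 0 < ‖u‖ := norm_pos_iff.2 hu0
    -- Equality would force `x i = x j` by the parallelogram law.
    have hu2 : ‖u‖ < 2 := by
      refine lt_of_le_of_ne ((norm_add_le _ _).trans_eq (by rw [hx, hx]; norm_num)) fun h => ?_
      have hpl := parallelogram_law_with_norm ℂ (x i) (x j)
      rw [← hu, h, hx, hx] at hpl
      have h0 : ‖x i - x j‖ = 0 := by nlinarith
      exact hne.1 (sub_eq_zero.1 (norm_eq_zero.1 h0)).symm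
    -- First move: change the sign of both `x i` and `x j`.
    have hflip : ‖s - (2 : ℝ) • u‖ ≤ ‖s‖ := by
      have hmem : Function.update (Function.update x i (-x i)) j (-x j) ∈
          U ∩ {x | ‖pairing T x‖ = injNorm T} := by
        refine ⟨(memU _).2 fun k => ?_, ?_⟩
        · simp only [Function.update_apply]
          split_ifs <;> simp [hx]
        · have h1 : pairingMultilinear T (Function.update (Function.update x i (-x i)) j (-x j)) =
              pairingMultilinear T x := by
            rw [MultilinearMap.map_update_neg, Function.update_comm hij,
              MultilinearMap.map_update_neg, neg_neg, Function.update_eq_self,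
              Function.update_eq_self]
          rw [Set.mem_ofPred_eq, ← pairingMultilinear_apply, h1, pairingMultilinear_apply, hxM]
      have := hxmax hmem
      simp only [Set.mem_ofPred_eq, sum_update_update hij] at this
      have e : s - (2 : ℝ) • u = ∑ k, x k - (x i + x j) + (-x i + -x j) := by
        rw [hs, hu]; module
      rwa [e]
    -- Second move: replace both vectors by `u / ‖u‖`, which is still maximising by
    -- `IsSymm.norm_pairing_add`.
    have hrep : ‖s + (2 / ‖u‖ - 1) • u‖ ≤ ‖s‖ := by
      set w : EuclideanSpace ℂ (Fin d) := ((‖u‖⁻¹ : ℝ) : ℂ) • u with hw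
      have hw1 : ‖w‖ = 1 := by
        rw [hw, norm_smul, Complex.norm_real, norm_inv, norm_norm, inv_mul_cancel₀ hupos.ne']
      have hmem : Function.update (Function.update x i w) j w ∈
          U ∩ {x | ‖pairing T x‖ = injNorm T} := by
        refine ⟨(memU _).2 fun k => ?_, ?_⟩
        · simp only [Function.update_apply]
          split_ifs <;> simp [hx, hw1]
        · rw [Set.mem_ofPred_eq, ← pairingMultilinear_apply, hw, MultilinearMap.map_update_smul,
            Function.update_comm hij, MultilinearMap.map_update_smul, Function.update_comm hij.symm,
            pairingMultilinear_apply, norm_smul, norm_smul, hT.norm_pairing_add hx hxM hij,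
            Complex.norm_real, norm_inv, norm_norm]
          rw [← hu]
          field_simp
      have := hxmax hmem
      simp only [Set.mem_ofPred_eq, sum_update_update hij] at this
      have hwr : w = (‖u‖⁻¹ : ℝ) • u := by rw [hw]; exact Complex.coe_smul _ _
      have e : s + (2 / ‖u‖ - 1) • u = ∑ k, x k - (x i + x j) + (w + w) := by
        rw [hwr, ← hs, ← hu]; module
      rwa [e]
    -- For the real inner product, `hflip` gives `⟨s, u⟩ ≥ ‖u‖² > 0`; adding the positive multiple
    -- `2/‖u‖ - 1` of `u` to `s` then strictly lengthens it, against `hrep`.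
    let _ := InnerProductSpace.rclikeToReal ℂ (EuclideanSpace ℂ (Fin d))
    have e1 : ‖s - (2 : ℝ) • u‖ ^ 2 = ‖s‖ ^ 2 - 4 * inner ℝ s u + 4 * ‖u‖ ^ 2 := by
      rw [norm_sub_sq_real, inner_smul_right, norm_smul]
      norm_num; ring
    have e2 : ‖s + (2 / ‖u‖ - 1) • u‖ ^ 2 = ‖s‖ ^ 2 + 2 * (2 / ‖u‖ - 1) * inner ℝ s u +
        (2 / ‖u‖ - 1) ^ 2 * ‖u‖ ^ 2 := by
      rw [norm_add_sq_real, inner_smul_right, norm_smul, mul_pow, Real.norm_eq_abs, sq_abs]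
      ring
    have hc : 0 < 2 / ‖u‖ - 1 := by
      rw [sub_pos, lt_div_iff₀ hupos]; linarith
    have i1 := pow_le_pow_left₀ (norm_nonneg _) hflip 2
    have i2 := pow_le_pow_left₀ (norm_nonneg _) hrep 2
    rw [e1] at i1
    rw [e2] at i2
    have hin : 0 < inner ℝ s u := by nlinarith [pow_pos hupos 2]
    nlinarith [mul_pos hc hin, mul_pos (pow_pos hc 2) (pow_pos hupos 2)]
  let i₀ : Fin p := ⟨0, hp⟩
  refine ⟨x i₀, hx _, ?_⟩
  have hε : ∀ k, ∃ ε : ℂ, ‖ε‖ = 1 ∧ x k = ε • x i₀ := fun k => by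
    rcases key i₀ k with h | h
    · exact ⟨1, by simp, by simp [h]⟩
    · exact ⟨-1, by simp, by simp [h]⟩
  choose ε hε1 hε2 using hε
  have hmul : pairing T x = (∏ k, ε k) • pairing T fun _ => x i₀ := by
    rw [← pairingMultilinear_apply, ← pairingMultilinear_apply, ← MultilinearMap.map_smul_univ,
      ← funext hε2]
  rw [← hxM, hmul, norm_smul, norm_prod]
  simp [hε1]

end

/-! ### Complex Gaussian integrals of homogeneous polynomials. -/

section

variable {p d : ℕ}

/-- Mixed moments of a circularly symmetric variable vanish off the diagonal. -/
theorem integral_pow_mul_conj_pow_eq_zero {Ω : Type*} [MeasurableSpace Ω] {μ : Measure Ω}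
    {Y : Ω → ℂ}
    (hY : ∀ θ : ℝ, IdentDistrib Y (fun ω => Complex.exp (θ * Complex.I) * Y ω) μ μ)
    {a b : ℕ} (hab : a ≠ b) : ∫ ω, Y ω ^ a * conj (Y ω) ^ b ∂μ = 0 := by
  -- Rotation by this angle multiplies `Y^a * conj Y^b` by `exp (i θ (a - b)) = -1`, so the integral
  -- equals its own negative.
  set θ : ℝ := Real.pi / ((a : ℝ) - b) with hθ
  have hab' : (a : ℝ) - b ≠ 0 := sub_ne_zero.2 (by exact_mod_cast hab)
  have h1 := ((hY θ).comp (u := fun z : ℂ => z ^ a * conj z ^ b) (by fun_prop)).integral_eq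
  simp only [Function.comp_def] at h1
  have hω : Complex.exp (θ * Complex.I) ^ a * conj (Complex.exp (θ * Complex.I)) ^ b = -1 := by
    rw [← Complex.exp_conj, ← Complex.exp_nat_mul, ← Complex.exp_nat_mul, ← Complex.exp_add,
      ← Complex.exp_pi_mul_I]
    congr 1
    have : (θ : ℂ) * ((a : ℂ) - b) = Real.pi := by
      rw [hθ]
      have : ((a : ℂ) - b) ≠ 0 := by exact_mod_cast hab'
      push_cast
      field_simp
    rw [map_mul, Complex.conj_ofReal, Complex.conj_I, ← this]
    ring
  have h2 : ∀ ω, (Complex.exp (θ * Complex.I) * Y ω) ^ a *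
      conj (Complex.exp (θ * Complex.I) * Y ω) ^ b = -1 * (Y ω ^ a * conj (Y ω) ^ b) := by
    intro ω
    rw [← hω, map_mul]
    ring
  simp only [h2, integral_const_mul] at h1
  have h3 : (2 : ℂ) * ∫ ω, Y ω ^ a * conj (Y ω) ^ b ∂μ = 0 := by linear_combination h1
  simpa using h3

/-- The standard complex Gaussian measure. -/
def stdComplexGaussian : Measure ℂ :=
  volume.withDensity fun z => ((Real.toNNReal (Real.exp (-‖z‖ ^ 2) / Real.pi) : NNReal) : ENNReal)

theorem integral_stdComplexGaussian {E : Type*} [NormedAddCommGroup E] [NormedSpace ℝ E]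
    (f : ℂ → E) :
    ∫ z, f z ∂stdComplexGaussian = ∫ z, (Real.exp (-‖z‖ ^ 2) / Real.pi) • f z := by
  rw [stdComplexGaussian, integral_withDensity_eq_integral_smul (by fun_prop)]
  congr with z
  rw [NNReal.smul_def, Real.coe_toNNReal _ (by positivity)]

theorem integral_norm_pow_stdComplexGaussian (m : ℕ) :
    ∫ z, ‖z‖ ^ (2 * m) ∂stdComplexGaussian = m.factorial := by
  have h := Complex.integral_rpow_mul_exp_neg_rpow (p := 2) (q := (2 * m : ℕ)) (by norm_num)
    (by linarith [Nat.cast_nonneg (α := ℝ) (2 * m)])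
  have hG : ((2 * m : ℕ) + 2 : ℝ) / 2 = m + 1 := by push_cast; ring
  rw [hG, Real.Gamma_nat_eq_factorial] at h
  rw [integral_stdComplexGaussian]
  have e : ∀ z : ℂ, (Real.exp (-‖z‖ ^ 2) / Real.pi) • ‖z‖ ^ (2 * m) =
      Real.pi⁻¹ * (‖z‖ ^ ((2 * m : ℕ) : ℝ) * Real.exp (-‖z‖ ^ (2 : ℝ))) := fun z => by
    rw [Real.rpow_natCast, Real.rpow_two, smul_eq_mul]; ring
  simp only [e, integral_const_mul, h]
  field_simp

theorem integrable_norm_pow_stdComplexGaussian (m : ℕ) :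
    Integrable (fun z : ℂ => ‖z‖ ^ (2 * m)) stdComplexGaussian := by
  -- A non-integrable function has Bochner integral `0` by convention, whereas the computed value
  -- `m!` is nonzero.
  by_contra h
  have h1 := integral_norm_pow_stdComplexGaussian m
  rw [integral_undef h] at h1
  exact (Nat.factorial_ne_zero m) (by exact_mod_cast h1.symm)

instance : IsProbabilityMeasure stdComplexGaussian := by
  have h0 := integral_norm_pow_stdComplexGaussian 0
  have : IsFiniteMeasure stdComplexGaussian := by
    have := integrable_norm_pow_stdComplexGaussian 0
    simpa [integrable_const_iff] using this
  constructor
  have h1 : stdComplexGaussian.real Set.univ = 1 := by simpa using h0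
  rwa [measureReal_def, ENNReal.toReal_eq_one_iff] at h1

theorem circular_stdComplexGaussian (θ : ℝ) :
    IdentDistrib (fun z : ℂ => z) (fun z => Complex.exp (θ * Complex.I) * z)
      stdComplexGaussian stdComplexGaussian := by
  have hmp : MeasurePreserving (fun z => Complex.exp (θ * Complex.I) * z)
      (volume : Measure ℂ) volume := by
    have := (rotation (Circle.exp θ)).measurePreserving
    have e : ⇑(rotation (Circle.exp θ)) = fun z => Complex.exp (θ * Complex.I) * z := by
      funext z
      rw [rotation_apply, Circle.coe_exp]
    rwa [e] at this
  refine ⟨by fun_prop, by fun_prop, ?_⟩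
  rw [Measure.map_id']
  ext s hs
  rw [Measure.map_apply (by fun_prop) hs, stdComplexGaussian, withDensity_apply _ hs,
    withDensity_apply _ (hs.preimage (by fun_prop)),
    ← hmp.setLIntegral_comp_preimage hs (by fun_prop)]
  simp [Complex.norm_exp_ofReal_mul_I]

/-- Cauchy–Schwarz after splitting off `√w`. It is applied with `w = α!`, the squared Gaussian `L²`
norm of the monomial with exponent `α`. -/
theorem sum_mul_sq_le_weighted {ι : Type*} (s : Finset ι) (a : ι → ℝ) (b w : ι → ℝ)
    (hw : ∀ i ∈ s, 0 < w i) :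
    (∑ i ∈ s, a i * b i) ^ 2 ≤ (∑ i ∈ s, a i ^ 2 * w i) * ∑ i ∈ s, b i ^ 2 / w i := by
  have h := Finset.sum_mul_sq_le_sq_mul_sq s (fun i => a i * √(w i)) (fun i => b i / √(w i))
  refine (le_of_eq ?_).trans (h.trans (le_of_eq ?_))
  · congr 1
    refine Finset.sum_congr rfl fun i hi => ?_
    have := (Real.sqrt_pos.2 (hw i hi)).ne'
    field_simp
  · congr 1 <;>
    · refine Finset.sum_congr rfl fun i hi => ?_
      simp only [mul_pow, div_pow, Real.sq_sqrt (hw i hi).le]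

/-- The product of standard complex Gaussian measures on `ℂ^d`. -/
def stdComplexGaussianPi (d : ℕ) : Measure (Fin d → ℂ) := Measure.pi fun _ => stdComplexGaussian

instance (d : ℕ) : IsProbabilityMeasure (stdComplexGaussianPi d) := by
  unfold stdComplexGaussianPi; infer_instance

theorem integral_pow_mul_conj_pow_stdComplexGaussian (a b : ℕ) :
    ∫ z, z ^ a * conj z ^ b ∂stdComplexGaussian = if a = b then (a.factorial : ℂ) else 0 := by
  split_ifs with h
  · subst h
    have e : ∀ z : ℂ, z ^ a * conj z ^ a = ((‖z‖ ^ (2 * a) : ℝ) : ℂ) := fun z => by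
      rw [← mul_pow, Complex.mul_conj, Complex.normSq_eq_norm_sq, pow_mul]
      push_cast; rfl
    simp only [e]
    rw [integral_complex_ofReal, integral_norm_pow_stdComplexGaussian]
    simp
  · exact integral_pow_mul_conj_pow_eq_zero circular_stdComplexGaussian h

theorem integrable_pow_mul_conj_pow {Ω : Type*} [MeasurableSpace Ω] {μ : Measure Ω} {Y : Ω → ℂ}
    (hY : AEMeasurable Y μ) (hint : ∀ k : ℕ, Integrable (fun ω => ‖Y ω‖ ^ (2 * k)) μ)
    (a b : ℕ) : Integrable (fun ω => Y ω ^ a * conj (Y ω) ^ b) μ := by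
  refine ((hint a).add (hint b)).mono'
    (((hY.pow_const a).mul ((Complex.continuous_conj.measurable.comp_aemeasurable hY).pow_const
      b)).aestronglyMeasurable) (Eventually.of_forall fun ω => ?_)
  rw [norm_mul, norm_pow, norm_pow, RCLike.norm_conj, Pi.add_apply, pow_mul', pow_mul']
  nlinarith [sq_nonneg (‖Y ω‖ ^ a - ‖Y ω‖ ^ b), sq_nonneg (‖Y ω‖ ^ a), sq_nonneg (‖Y ω‖ ^ b)]

theorem monomial_mul_conj_eq_prod (α β : Fin d → ℕ) (g : Fin d → ℂ) :
    (∏ i, g i ^ α i) * conj (∏ i, g i ^ β i) = ∏ i, (g i ^ α i * conj (g i) ^ β i) := by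
  rw [map_prod, ← Finset.prod_mul_distrib]
  simp

theorem integrable_monomial_mul_conj (α β : Fin d → ℕ) :
    Integrable (fun g : Fin d → ℂ => (∏ i, g i ^ α i) * conj (∏ i, g i ^ β i))
      (stdComplexGaussianPi d) := by
  simp only [monomial_mul_conj_eq_prod]
  exact Integrable.fintype_prod (f := fun i z => z ^ α i * conj z ^ β i) fun i =>
    integrable_pow_mul_conj_pow (Y := fun z => z) (by fun_prop)
      integrable_norm_pow_stdComplexGaussian _ _

theorem integral_monomial_mul_conj (α β : Fin d → ℕ) :
    ∫ g, (∏ i, g i ^ α i) * conj (∏ i, g i ^ β i) ∂(stdComplexGaussianPi d) =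
      if α = β then ∏ i, ((α i).factorial : ℂ) else 0 := by
  simp only [monomial_mul_conj_eq_prod]
  rw [stdComplexGaussianPi,
    integral_fintype_prod_eq_prod (fun i z => z ^ α i * conj z ^ β i)]
  simp only [integral_pow_mul_conj_pow_stdComplexGaussian]
  split_ifs with h
  · subst h; simp
  · obtain ⟨i, hi⟩ := Function.ne_iff.1 h
    exact Finset.prod_eq_zero (Finset.mem_univ i) (if_neg hi)

theorem ofReal_norm_sq_eval (f : MvPolynomial (Fin d) ℂ) (g : Fin d → ℂ) :
    ((‖MvPolynomial.eval g f‖ ^ 2 : ℝ) : ℂ) = ∑ α ∈ f.support, ∑ β ∈ f.support,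
      (f.coeff α * conj (f.coeff β)) * ((∏ i, g i ^ α i) * conj (∏ i, g i ^ β i)) := by
  rw [Complex.ofReal_pow, ← Complex.mul_conj', MvPolynomial.eval_eq', map_sum,
    Finset.sum_mul_sum]
  refine Finset.sum_congr rfl fun α _ => Finset.sum_congr rfl fun β _ => ?_
  rw [map_mul]; ring

theorem integrable_norm_sq_eval (f : MvPolynomial (Fin d) ℂ) :
    Integrable (fun g => ‖MvPolynomial.eval g f‖ ^ 2) (stdComplexGaussianPi d) := by
  have h : Integrable (fun g => ((‖MvPolynomial.eval g f‖ ^ 2 : ℝ) : ℂ))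
      (stdComplexGaussianPi d) := by
    simp only [ofReal_norm_sq_eval]
    exact integrable_finsetSum _ fun α _ => integrable_finsetSum _ fun β _ =>
      (integrable_monomial_mul_conj α β).const_mul _
  exact h.re

/-- The Gaussian `L²` norm of a polynomial in terms of its coefficients. -/
theorem integral_norm_sq_eval (f : MvPolynomial (Fin d) ℂ) :
    ∫ g, ‖MvPolynomial.eval g f‖ ^ 2 ∂(stdComplexGaussianPi d) =
      ∑ α ∈ f.support, ‖f.coeff α‖ ^ 2 * ∏ i, ((α i).factorial : ℝ) := by
  rw [← Complex.ofReal_inj, ← integral_complex_ofReal]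
  simp only [ofReal_norm_sq_eval]
  rw [integral_finsetSum _ fun (α : Fin d →₀ ℕ) _ => integrable_finsetSum _
      fun (β : Fin d →₀ ℕ) _ => (integrable_monomial_mul_conj α β).const_mul _,
    Complex.ofReal_sum]
  refine Finset.sum_congr rfl fun α hα => ?_
  rw [integral_finsetSum _ fun (β : Fin d →₀ ℕ) _ =>
      (integrable_monomial_mul_conj α β).const_mul _, Finset.sum_eq_single α]
  · rw [integral_const_mul, integral_monomial_mul_conj, if_pos rfl, Complex.mul_conj']
    push_cast; rfl
  · intro β _ hβ
    rw [integral_const_mul, integral_monomial_mul_conj, if_neg, mul_zero]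
    exact fun h => hβ (DFunLike.coe_injective h).symm
  · exact fun h => absurd hα h

theorem multinomial_eq_div {α : Fin d → ℕ} {n : ℕ} (h : ∑ i, α i = n) :
    (Nat.multinomial Finset.univ α : ℝ) = n.factorial / ∏ i, ((α i).factorial : ℝ) := by
  rw [eq_div_iff (Finset.prod_ne_zero_iff.2 fun i _ => by positivity), mul_comm]
  exact_mod_cast h ▸ Nat.multinomial_spec Finset.univ α

/-- A homogeneous polynomial is bounded pointwise by its Gaussian `L²` norm. -/
theorem norm_sq_eval_le {f : MvPolynomial (Fin d) ℂ} {n : ℕ} (hf : f.IsHomogeneous n)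
    (x : Fin d → ℂ) :
    n.factorial * ‖MvPolynomial.eval x f‖ ^ 2 ≤
      (∑ i, ‖x i‖ ^ 2) ^ n * ∫ g, ‖MvPolynomial.eval g f‖ ^ 2 ∂(stdComplexGaussianPi d) := by
  have hdeg : ∀ α ∈ f.support, ∑ i, α i = n := fun α hα => by
    have := hf (MvPolynomial.mem_support_iff.1 hα)
    rw [Finsupp.weight_apply, Finsupp.sum_fintype _ _ (by simp)] at this
    simpa using this
  have h1 : ‖MvPolynomial.eval x f‖ ≤ ∑ α ∈ f.support, ‖f.coeff α‖ * ∏ i, ‖x i‖ ^ α i := by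
    rw [MvPolynomial.eval_eq']
    refine (norm_sum_le _ _).trans_eq (Finset.sum_congr rfl fun α _ => ?_)
    rw [norm_mul, norm_prod]
    simp
  have h2 := sum_mul_sq_le_weighted f.support (fun α => ‖f.coeff α‖)
    (fun α => ∏ i, ‖x i‖ ^ α i) (fun α => ∏ i, ((α i).factorial : ℝ))
    (fun α _ => Finset.prod_pos fun i _ => by positivity)
  rw [← integral_norm_sq_eval] at h2
  -- Over all exponents of degree `n` this is the multinomial theorem; only those in the support
  -- occur, hence the inequality.
  have h3 : n.factorial * ∑ α ∈ f.support,
      (∏ i, ‖x i‖ ^ α i) ^ 2 / ∏ i, ((α i).factorial : ℝ) ≤ (∑ i, ‖x i‖ ^ 2) ^ n := by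
    rw [Finset.sum_pow_eq_sum_piAntidiag, Finset.mul_sum]
    refine le_trans (le_of_eq ?_) (Finset.sum_le_sum_of_subset_of_nonneg
      (s := f.support.map ⟨fun α : Fin d →₀ ℕ => (α : Fin d → ℕ), DFunLike.coe_injective⟩)
      ?_ fun _ _ _ => by positivity)
    · rw [Finset.sum_map]
      refine Finset.sum_congr rfl fun α hα => ?_
      rw [Function.Embedding.coeFn_mk, multinomial_eq_div (hdeg α hα), ← Finset.prod_pow]
      simp only [← pow_mul, mul_comm 2]
      ring
    · intro k hk
      obtain ⟨α, hα, rfl⟩ := Finset.mem_map.1 hk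
      simpa using hdeg α hα
  have h4 : 0 ≤ ∫ g, ‖MvPolynomial.eval g f‖ ^ 2 ∂(stdComplexGaussianPi d) :=
    integral_nonneg fun _ => by positivity
  calc _ ≤ (n.factorial : ℝ) * (∑ α ∈ f.support, ‖f.coeff α‖ * ∏ i, ‖x i‖ ^ α i) ^ 2 := by gcongr
    _ ≤ n.factorial * ((∫ g, ‖MvPolynomial.eval g f‖ ^ 2 ∂(stdComplexGaussianPi d)) *
        ∑ α ∈ f.support, (∏ i, ‖x i‖ ^ α i) ^ 2 / ∏ i, ((α i).factorial : ℝ)) := by gcongr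
    _ ≤ _ := by
      rw [mul_left_comm, mul_comm]
      gcongr

theorem card_piAntidiag_univ (hd : 1 ≤ d) (n : ℕ) :
    (Finset.piAntidiag (Finset.univ : Finset (Fin d)) n).card = (n + d - 1).choose (d - 1) := by
  rw [← Finset.map_sym_eq_piAntidiag, Finset.card_map, Finset.sym_univ, Finset.card_univ,
    Sym.card_sym_eq_choose, Fintype.card_fin, ← Nat.choose_symm (by omega)]
  congr 1 <;> omega

theorem norm_sq_pow_eq_sum (n : ℕ) (g : Fin d → ℂ) :
    ((∑ i, ‖g i‖ ^ 2) ^ n : ℝ) = ∑ k ∈ Finset.piAntidiag (Finset.univ : Finset (Fin d)) n,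
      Nat.multinomial Finset.univ k * ∏ i, ‖g i‖ ^ (2 * k i) := by
  rw [Finset.sum_pow_eq_sum_piAntidiag]
  simp only [pow_mul]

theorem integrable_prod_norm_pow (k : Fin d → ℕ) :
    Integrable (fun g : Fin d → ℂ => ∏ i, ‖g i‖ ^ (2 * k i)) (stdComplexGaussianPi d) :=
  Integrable.fintype_prod (f := fun i (z : ℂ) => ‖z‖ ^ (2 * k i)) fun _ =>
    integrable_norm_pow_stdComplexGaussian _

theorem integrable_norm_sq_pow (n : ℕ) :
    Integrable (fun g : Fin d → ℂ => (∑ i, ‖g i‖ ^ 2) ^ n) (stdComplexGaussianPi d) := by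
  simp only [norm_sq_pow_eq_sum]
  exact integrable_finsetSum _ fun k _ => (integrable_prod_norm_pow k).const_mul _

/-- In the multinomial expansion every exponent `k` contributes `(n! / ∏ kᵢ!) · ∏ kᵢ! = n!`, so the
integral is `n!` times the number of monomials of degree `n`. -/
theorem integral_norm_sq_pow (hd : 1 ≤ d) (n : ℕ) :
    ∫ g, (∑ i, ‖g i‖ ^ 2) ^ n ∂(stdComplexGaussianPi d) =
      n.factorial * ((n + d - 1).choose (d - 1) : ℝ) := by
  simp only [norm_sq_pow_eq_sum]
  rw [integral_finsetSum _ fun k _ => (integrable_prod_norm_pow k).const_mul _,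
    ← card_piAntidiag_univ hd, mul_comm, ← nsmul_eq_mul]
  refine Finset.sum_eq_card_nsmul fun k hk => ?_
  rw [integral_const_mul, stdComplexGaussianPi,
    integral_fintype_prod_eq_prod (fun i (z : ℂ) => ‖z‖ ^ (2 * k i))]
  simp only [integral_norm_pow_stdComplexGaussian]
  rw [multinomial_eq_div (Finset.mem_piAntidiag.1 hk).1,
    div_mul_cancel₀ _ (Finset.prod_ne_zero_iff.2 fun i _ => by positivity)]

end

/-! ### Stability of rigid sub-Gaussianity under linear combinations. -/

section

variable {p d : ℕ}

namespace IsRigidlySubGaussian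

variable {Ω Ω' : Type*} [MeasurableSpace Ω] [MeasurableSpace Ω'] {μ : Measure Ω} {ν : Measure Ω'}
  {X Y : Ω → ℂ}

theorem aemeasurable (h : IsRigidlySubGaussian Y μ) : AEMeasurable Y μ :=
  (h.circular 0).aemeasurable_fst

theorem of_identDistrib {Z : Ω' → ℂ} (h : IsRigidlySubGaussian Y μ) (hZ : IdentDistrib Z Y ν μ) :
    IsRigidlySubGaussian Z ν := by
  have hpow : ∀ k : ℕ, IdentDistrib (fun ω => ‖Z ω‖ ^ k) (fun ω => ‖Y ω‖ ^ k) ν μ := fun k =>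
    hZ.comp (u := fun z : ℂ => ‖z‖ ^ k) (by fun_prop)
  refine ⟨fun θ => ?_, fun k => ?_, fun k => ?_⟩
  · exact (hZ.trans (h.circular θ)).trans
      (hZ.symm.comp (u := fun z => Complex.exp (θ * Complex.I) * z) (by fun_prop))
  · exact (hpow _).integrable_iff.2 (h.integrable_pow k)
  · rw [(hpow _).integral_eq, (hpow _).integral_eq]
    exact h.moment_le k

theorem const_mul (h : IsRigidlySubGaussian Y μ) (c : ℂ) :
    IsRigidlySubGaussian (fun ω => c * Y ω) μ := by
  refine ⟨fun θ => ?_, fun k => ?_, fun k => ?_⟩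
  · convert! (h.circular θ).comp (u := fun z => c * z) (by fun_prop) using 2 with ω
    simp only [Function.comp]; ring
  · simp only [norm_mul, mul_pow]
    exact (h.integrable_pow k).const_mul _
  · simp only [norm_mul, mul_pow, integral_const_mul]
    rw [pow_mul, mul_left_comm]
    exact mul_le_mul_of_nonneg_left (h.moment_le k) (by positivity)

theorem conj_comp (h : IsRigidlySubGaussian Y μ) : IsRigidlySubGaussian (fun ω => conj (Y ω)) μ := by
  refine ⟨fun θ => ?_, fun k => ?_, fun k => ?_⟩
  · convert! (h.circular (-θ)).comp (u := fun z => (starRingEnd ℂ) z) (by fun_prop) using 2 with ω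
    simp [← Complex.exp_conj]
  · simpa using h.integrable_pow k
  · simpa using h.moment_le k

theorem congr_ae (h : IsRigidlySubGaussian Y μ) (hXY : X =ᵐ[μ] Y) : IsRigidlySubGaussian X μ :=
  h.of_identDistrib (IdentDistrib.of_ae_eq (h.aemeasurable.congr hXY.symm) hXY)

theorem integral_pow_mul_conj_pow (h : IsRigidlySubGaussian Y μ) (a b : ℕ) :
    ∫ ω, Y ω ^ a * (starRingEnd ℂ) (Y ω) ^ b ∂μ =
      if a = b then ((∫ ω, ‖Y ω‖ ^ (2 * a) ∂μ : ℝ) : ℂ) else 0 := by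
  split_ifs with hab
  · subst hab
    rw [← integral_complex_ofReal]
    congr with ω
    rw [← mul_pow, Complex.mul_conj, Complex.normSq_eq_norm_sq, pow_mul]
    push_cast; rfl
  · exact integral_pow_mul_conj_pow_eq_zero h.circular hab

theorem norm_add_pow_eq (x y : ℂ) (k : ℕ) : ((‖x + y‖ ^ (2 * k) : ℝ) : ℂ) =
    ∑ a ∈ Finset.range (k + 1), ∑ b ∈ Finset.range (k + 1), ((k.choose a : ℂ) * k.choose b) *
      ((x ^ a * (starRingEnd ℂ) x ^ b) * (y ^ (k - a) * (starRingEnd ℂ) y ^ (k - b))) := by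
  have h : ((‖x + y‖ ^ (2 * k) : ℝ) : ℂ) = (x + y) ^ k * (starRingEnd ℂ) (x + y) ^ k := by
    rw [← mul_pow, Complex.mul_conj, Complex.normSq_eq_norm_sq, pow_mul]
    push_cast; rfl
  rw [h, map_add, add_pow, add_pow, Finset.sum_mul_sum]
  refine Finset.sum_congr rfl fun a _ => Finset.sum_congr rfl fun b _ => ?_
  ring

theorem integrable_mixed (hX : IsRigidlySubGaussian X μ) (hY : IsRigidlySubGaussian Y μ)
    (hXY : IndepFun X Y μ) (a b a' b' : ℕ) :
    Integrable (fun ω => (X ω ^ a * (starRingEnd ℂ) (X ω) ^ b) *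
      (Y ω ^ a' * (starRingEnd ℂ) (Y ω) ^ b')) μ :=
  (hXY.comp (φ := fun z : ℂ => z ^ a * (starRingEnd ℂ) z ^ b)
    (ψ := fun z : ℂ => z ^ a' * (starRingEnd ℂ) z ^ b') (by fun_prop) (by fun_prop)).integrable_mul
    (integrable_pow_mul_conj_pow hX.aemeasurable hX.integrable_pow a b)
    (integrable_pow_mul_conj_pow hY.aemeasurable hY.integrable_pow a' b')

theorem integral_mixed (hX : IsRigidlySubGaussian X μ) (hY : IsRigidlySubGaussian Y μ)
    (hXY : IndepFun X Y μ) (a b a' b' : ℕ) :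
    ∫ ω, (X ω ^ a * (starRingEnd ℂ) (X ω) ^ b) *
      (Y ω ^ a' * (starRingEnd ℂ) (Y ω) ^ b') ∂μ =
    (∫ ω, X ω ^ a * (starRingEnd ℂ) (X ω) ^ b ∂μ) *
      ∫ ω, Y ω ^ a' * (starRingEnd ℂ) (Y ω) ^ b' ∂μ :=
  hXY.integral_fun_comp_mul_comp (f := fun z : ℂ => z ^ a * (starRingEnd ℂ) z ^ b)
    (g := fun z : ℂ => z ^ a' * (starRingEnd ℂ) z ^ b') hX.aemeasurable hY.aemeasurable
    (by fun_prop) (by fun_prop)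

theorem integrable_norm_add_pow (hX : IsRigidlySubGaussian X μ) (hY : IsRigidlySubGaussian Y μ)
    (hXY : IndepFun X Y μ) (k : ℕ) : Integrable (fun ω => ‖X ω + Y ω‖ ^ (2 * k)) μ := by
  have h : Integrable (fun ω => ((‖X ω + Y ω‖ ^ (2 * k) : ℝ) : ℂ)) μ := by
    simp only [norm_add_pow_eq]
    exact integrable_finsetSum _ fun a _ => integrable_finsetSum _ fun b _ =>
      (integrable_mixed hX hY hXY _ _ _ _).const_mul _
  exact h.re

/-- In the expansion of `(x + y)^k * conj (x + y)^k`, independence factors each term and circularity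
kills those with `a ≠ b`. -/
theorem integral_norm_add_pow (hX : IsRigidlySubGaussian X μ) (hY : IsRigidlySubGaussian Y μ)
    (hXY : IndepFun X Y μ) (k : ℕ) : ∫ ω, ‖X ω + Y ω‖ ^ (2 * k) ∂μ =
      ∑ a ∈ Finset.range (k + 1), (k.choose a : ℝ) ^ 2 *
        ((∫ ω, ‖X ω‖ ^ (2 * a) ∂μ) * ∫ ω, ‖Y ω‖ ^ (2 * (k - a)) ∂μ) := by
  rw [← Complex.ofReal_inj, ← integral_complex_ofReal]
  simp only [norm_add_pow_eq]
  rw [integral_finsetSum _ fun a _ => integrable_finsetSum _ fun b _ =>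
      (integrable_mixed hX hY hXY _ _ _ _).const_mul _, Complex.ofReal_sum]
  refine Finset.sum_congr rfl fun a ha => ?_
  rw [integral_finsetSum _ fun b _ => (integrable_mixed hX hY hXY _ _ _ _).const_mul _,
    Finset.sum_eq_single a]
  · rw [integral_const_mul, integral_mixed hX hY hXY, hX.integral_pow_mul_conj_pow,
      hY.integral_pow_mul_conj_pow, if_pos rfl, if_pos rfl]
    push_cast
    ring
  · intro b _ hb
    rw [integral_const_mul, integral_mixed hX hY hXY, hX.integral_pow_mul_conj_pow,
      if_neg hb.symm, zero_mul, mul_zero]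
  · exact fun h => absurd ha h

variable [IsProbabilityMeasure μ]

theorem integral_norm_add_sq (hX : IsRigidlySubGaussian X μ) (hY : IsRigidlySubGaussian Y μ)
    (hXY : IndepFun X Y μ) :
    ∫ ω, ‖X ω + Y ω‖ ^ 2 ∂μ = ∫ ω, ‖X ω‖ ^ 2 ∂μ + ∫ ω, ‖Y ω‖ ^ 2 ∂μ := by
  have h := integral_norm_add_pow hX hY hXY 1
  simp [Finset.sum_range_succ] at h
  linarith

/-- The constant `k!` is exactly reproduced: since `C(k,a)² a! (k-a)! = k! C(k,a)`, bounding each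
factor leaves `k!` times a binomial expansion of the summed variances. -/
theorem add (hX : IsRigidlySubGaussian X μ) (hY : IsRigidlySubGaussian Y μ)
    (hXY : IndepFun X Y μ) : IsRigidlySubGaussian (fun ω => X ω + Y ω) μ := by
  refine ⟨fun θ => ?_, integrable_norm_add_pow hX hY hXY, fun k => ?_⟩
  · have h := ((hX.circular θ).prodMk (hY.circular θ) hXY
      (hXY.comp (φ := fun z : ℂ => Complex.exp (θ * Complex.I) * z)
        (ψ := fun z : ℂ => Complex.exp (θ * Complex.I) * z) (by fun_prop) (by fun_prop))).comp
      (u := fun z : ℂ × ℂ => z.1 + z.2) (by fun_prop)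
    convert! h using 2 with ω
    simp only [Function.comp]; ring
  · rw [integral_norm_add_pow hX hY hXY, integral_norm_add_sq hX hY hXY, add_pow, Finset.mul_sum]
    refine Finset.sum_le_sum fun a ha => ?_
    have hak : a ≤ k := Nat.lt_succ_iff.1 (Finset.mem_range.1 ha)
    have h1 : (k.choose a : ℝ) * (a.factorial * (k - a).factorial) = k.factorial := by
      rw [← mul_assoc]; exact_mod_cast Nat.choose_mul_factorial_mul_factorial hak
    rw [← h1]
    have hpos : 0 ≤ ∫ ω, ‖Y ω‖ ^ (2 * (k - a)) ∂μ := integral_nonneg fun _ => by positivity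
    have hpos' : 0 ≤ ∫ ω, ‖X ω‖ ^ 2 ∂μ := integral_nonneg fun _ => by positivity
    calc _ ≤ (k.choose a : ℝ) ^ 2 * ((a.factorial * (∫ ω, ‖X ω‖ ^ 2 ∂μ) ^ a) *
          ((k - a).factorial * (∫ ω, ‖Y ω‖ ^ 2 ∂μ) ^ (k - a))) := by
          gcongr
          · exact hX.moment_le a
          · exact hY.moment_le (k - a)
      _ = _ := by ring

theorem zero : IsRigidlySubGaussian (fun _ : Ω => (0 : ℂ)) μ := by
  refine ⟨fun θ => ?_, fun k => by simp, fun k => ?_⟩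
  · simpa using IdentDistrib.refl aemeasurable_const
  · rcases Nat.eq_zero_or_pos k with rfl | hk
    · simp
    · simp [hk.ne']

theorem sum {ι : Type*} {Z : ι → Ω → ℂ} (hZ : ∀ i, IsRigidlySubGaussian (Z i) μ)
    (hind : iIndepFun Z μ) (s : Finset ι) :
    IsRigidlySubGaussian (fun ω => ∑ i ∈ s, Z i ω) μ ∧
      ∫ ω, ‖∑ i ∈ s, Z i ω‖ ^ 2 ∂μ = ∑ i ∈ s, ∫ ω, ‖Z i ω‖ ^ 2 ∂μ := by
  classical
  induction s using Finset.induction_on with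
  | empty => simpa using zero
  | insert i s hi ih =>
    have hi' : IndepFun (Z i) (fun ω => ∑ j ∈ s, Z j ω) μ := by
      have := hind.indepFun_finsetSum_of_notMem₀ (fun i => (hZ i).aemeasurable) hi
      convert! this.symm using 1
      funext ω
      simp
    simp only [Finset.sum_insert hi]
    exact ⟨(hZ i).add ih.1 hi', by rw [integral_norm_add_sq (hZ i) ih.1 hi', ih.2]⟩

/-- Linear combinations of conjugates of independent rigidly sub-Gaussian variables. -/
theorem sum_conj_mul {ι : Type*} [Fintype ι] {Z : ι → Ω → ℂ}
    (hZ : ∀ i, IsRigidlySubGaussian (Z i) μ) (hind : iIndepFun Z μ) (c : ι → ℂ) :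
    IsRigidlySubGaussian (fun ω => ∑ i, (starRingEnd ℂ) (Z i ω) * c i) μ ∧
      ∫ ω, ‖∑ i, (starRingEnd ℂ) (Z i ω) * c i‖ ^ 2 ∂μ =
        ∑ i, ‖c i‖ ^ 2 * ∫ ω, ‖Z i ω‖ ^ 2 ∂μ := by
  have h := sum (Z := fun i ω => c i * (starRingEnd ℂ) (Z i ω))
    (fun i => (hZ i).conj_comp.const_mul (c i))
    (hind.comp (fun i z => c i * (starRingEnd ℂ) z) (fun i => by fun_prop)) Finset.univ
  simp only [mul_comm (c _)] at h
  refine ⟨h.1, h.2.trans (Finset.sum_congr rfl fun i _ => ?_)⟩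
  simp only [norm_mul, mul_pow, RCLike.norm_conj]
  rw [integral_mul_const, mul_comm]

end IsRigidlySubGaussian

end

/-! ### Diagonal moments of the two models. -/

section

variable {p d : ℕ}

/-- The nondecreasing rearrangement of a multi-index. -/
def sortIndex (I : Fin p → Fin d) : {I : Fin p → Fin d // Monotone I} :=
  ⟨I ∘ Tuple.sort I, Tuple.monotone_sort I⟩

theorem sortIndex_comp (J : {I : Fin p → Fin d // Monotone I}) (σ : Equiv.Perm (Fin p)) :
    sortIndex (J.1 ∘ σ) = J := by
  refine Subtype.ext ?_
  have := Tuple.comp_perm_comp_sort_eq_comp_sort (f := J.1) (σ := σ)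
  exact this.trans (by rw [Tuple.sort_eq_refl_iff_monotone.2 J.2]; rfl)

theorem eq_sortIndex_comp (I : Fin p → Fin d) : I = (sortIndex I).1 ∘ (Tuple.sort I).symm := by
  ext k; simp [sortIndex]

theorem stabCard_pos (I : Fin p → Fin d) : 0 < stabCard I := by
  have : Nonempty {σ : Equiv.Perm (Fin p) // I ∘ σ = I} := ⟨⟨1, rfl⟩⟩
  exact Nat.card_pos

/-- Right multiplication by `τ⁻¹` carries this coset onto the stabilizer. -/
theorem card_perm_comp_eq (J : Fin p → Fin d) (τ : Equiv.Perm (Fin p)) :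
    (Finset.univ.filter fun σ : Equiv.Perm (Fin p) => J ∘ σ = J ∘ τ).card = stabCard J := by
  rw [stabCard, Nat.card_eq_fintype_card, Fintype.card_subtype]
  refine Finset.card_bij (fun σ _ => σ * τ⁻¹) ?_ ?_ ?_
  · intro σ hσ
    simp only [Finset.mem_filter, Finset.mem_univ, true_and] at hσ ⊢
    rw [Equiv.Perm.coe_mul, ← Function.comp_assoc, hσ, Function.comp_assoc, ← Equiv.Perm.coe_mul]
    simp
  · intro σ _ σ' _ h
    simpa using h
  · intro σ hσ
    simp only [Finset.mem_filter, Finset.mem_univ, true_and] at hσ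
    refine ⟨σ * τ, ?_, by simp⟩
    simp only [Finset.mem_filter, Finset.mem_univ, true_and]
    rw [Equiv.Perm.coe_mul, ← Function.comp_assoc, hσ]

/-- Orbit-stabilizer for the permutation action on multi-indices. -/
theorem card_sortIndex_fiber_mul (J : {I : Fin p → Fin d // Monotone I}) :
    (Finset.univ.filter fun I : Fin p → Fin d => sortIndex I = J).card * stabCard J.1 =
      p.factorial := by
  have h := Finset.card_eq_sum_card_fiberwise (s := (Finset.univ : Finset (Equiv.Perm (Fin p))))
    (f := fun σ : Equiv.Perm (Fin p) => J.1 ∘ ⇑σ) (t := Finset.univ.filter fun I : Fin p → Fin d => sortIndex I = J)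
    (fun σ _ => by simp [sortIndex_comp])
  rw [Finset.card_univ, Fintype.card_perm, Fintype.card_fin] at h
  rw [h, ← smul_eq_mul]
  refine (Finset.sum_eq_card_nsmul fun I hI => ?_).symm
  have hI' : sortIndex I = J := by simpa using hI
  have e := eq_sortIndex_comp I
  rw [hI'] at e
  rw [e]
  exact card_perm_comp_eq J.1 _

/-- Each orbit has `p! / |Stab|` elements. The lemma rewrites the diagonal pairing of a symmetric
tensor through its independent entries. -/
theorem sum_eq_sum_monotone (F : (Fin p → Fin d) → ℂ)
    (hF : ∀ (σ : Equiv.Perm (Fin p)) I, F (I ∘ σ) = F I) :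
    ∑ I, F I = ∑ J : {I : Fin p → Fin d // Monotone I},
      ((p.factorial : ℂ) / stabCard J.1) * F J.1 := by
  rw [← Finset.sum_fiberwise (s := Finset.univ) (g := sortIndex)]
  refine Finset.sum_congr rfl fun J _ => ?_
  rw [← card_sortIndex_fiber_mul J, Nat.cast_mul,
    mul_div_cancel_right₀ _ (by exact_mod_cast (stabCard_pos J.1).ne'), ← nsmul_eq_mul]
  refine Finset.sum_eq_card_nsmul fun I hI => ?_
  have hI' : sortIndex I = J := by simpa using hI
  conv_lhs => rw [eq_sortIndex_comp I, hI']
  exact hF _ _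

theorem prod_comp_perm (g : Fin d → ℂ) (σ : Equiv.Perm (Fin p)) (I : Fin p → Fin d) :
    ∏ k, g ((I ∘ σ) k) = ∏ k, g (I k) :=
  Equiv.prod_comp σ fun k => g (I k)

theorem sum_norm_sq_prod (g : Fin d → ℂ) :
    ∑ I : Fin p → Fin d, ‖∏ k, g (I k)‖ ^ 2 = (∑ i, ‖g i‖ ^ 2) ^ p := by
  rw [Fintype.sum_pow]
  simp only [norm_prod, ← Finset.prod_pow]

/-- Moment control of a random tensor on the diagonal. -/
structure HasDiagonalMoments {Ω : Type*} [MeasurableSpace Ω] (B : Ω → Tensor p d)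
    (μ : Measure Ω) : Prop where
  symm : ∀ᵐ ω ∂μ, IsSymm (B ω)
  aemeasurable : AEMeasurable B μ
  integrable : ∀ I, Integrable (fun ω => ‖B ω I‖) μ
  rigid : ∀ g : Fin d → ℂ,
    IsRigidlySubGaussian (fun ω => pairing (B ω) fun _ => WithLp.toLp 2 g) μ
  variance : ∀ g : Fin d → ℂ, ∫ ω, ‖pairing (B ω) fun _ => WithLp.toLp 2 g‖ ^ 2 ∂μ =
    1 / d * (∑ i, ‖g i‖ ^ 2) ^ p

theorem IsRigidlySubGaussian.integrable_norm {Ω : Type*} [MeasurableSpace Ω] {μ : Measure Ω}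
    {Y : Ω → ℂ} (h : IsRigidlySubGaussian Y μ) :
    Integrable (fun ω => ‖Y ω‖) μ := by
  refine ((h.integrable_pow 0).add (h.integrable_pow 1)).mono' h.aemeasurable.norm.aestronglyMeasurable
    (Eventually.of_forall fun ω => ?_)
  simp only [norm_norm, Pi.add_apply]
  rw [mul_zero, mul_one, pow_zero]
  nlinarith [sq_nonneg (‖Y ω‖ - 1)]

variable {Ω : Type*} [MeasurableSpace Ω] {μ : Measure Ω} [IsProbabilityMeasure μ]

theorem symProj_isSymm (T : Tensor p d) : IsSymm (symProj T) := by
  intro σ I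
  simp only [symProj]
  congr 1
  exact Fintype.sum_equiv (Equiv.mulLeft σ) _ _ fun τ => rfl

/-- The tensor `g^{⊗p}` is permutation invariant, so symmetrizing `T` is invisible on the diagonal
and the independent entries of `T` can be used directly. -/
theorem pairing_symProj (T : Tensor p d) (g : Fin d → ℂ) :
    pairing (symProj T) (fun _ => WithLp.toLp 2 g) = pairing T fun _ => WithLp.toLp 2 g := by
  have h : ∀ σ : Equiv.Perm (Fin p), ∑ I : Fin p → Fin d, conj (T (I ∘ σ)) * ∏ k, g (I k) =
      ∑ I : Fin p → Fin d, conj (T I) * ∏ k, g (I k) := fun σ => by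
    refine Fintype.sum_equiv (σ.arrowCongr (Equiv.refl (Fin d))).symm _ _ fun I => ?_
    have hI : ((σ.arrowCongr (Equiv.refl (Fin d))).symm I) = I ∘ σ := by
      ext; simp [Equiv.arrowCongr]
    rw [hI, prod_comp_perm]
  simp only [pairing, symProj, map_mul, map_sum, mul_assoc, Finset.sum_mul, Finset.mul_sum]
  rw [Finset.sum_comm]
  simp only [← Finset.mul_sum, h]
  simp [Fintype.card_perm, Nat.factorial_ne_zero]

theorem ModelSTilde.hasDiagonalMoments {B : Ω → Tensor p d} (h : ModelSTilde B μ) :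
    HasDiagonalMoments B μ := by
  obtain ⟨T, hT, hB⟩ := h
  have key := fun g : Fin d → ℂ => IsRigidlySubGaussian.sum_conj_mul hT.rigid hT.indep
    fun I => ∏ k, g (I k)
  have hae : ∀ g : Fin d → ℂ, (fun ω => pairing (B ω) fun _ => WithLp.toLp 2 g) =ᵐ[μ]
      fun ω => ∑ I, conj (T ω I) * ∏ k, g (I k) := fun g => by
    filter_upwards [hB] with ω hω
    rw [hω, pairing_symProj]
    rfl
  have hTm : AEMeasurable T μ := aemeasurable_pi_iff.2 fun I => (hT.rigid I).aemeasurable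
  have hm : Measurable (symProj : Tensor p d → Tensor p d) := by
    unfold symProj
    fun_prop
  refine ⟨?_, ?_, fun I => ?_, fun g => (key g).1.congr_ae (hae g), fun g => ?_⟩
  · filter_upwards [hB] with ω hω
    rw [hω]
    exact symProj_isSymm _
  · exact (hm.comp_aemeasurable hTm).congr (hB.mono fun ω hω => hω.symm)
  · have hT1 : Integrable (fun ω => symProj (T ω) I) μ := by
      simp only [symProj]
      refine (integrable_finsetSum _ fun σ _ => ?_).const_mul _
      exact (integrable_norm_iff (hT.rigid _).aemeasurable.aestronglyMeasurable).1
        (hT.rigid _).integrable_norm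
    exact (hT1.congr (hB.mono fun ω hω => by simp only [hω])).norm
  · rw [integral_congr_ae ((hae g).mono fun ω hω => by simp only [hω]; rfl), (key g).2]
    simp only [hT.variance]
    rw [← Finset.sum_mul, sum_norm_sq_prod, mul_comm]

/-- The entry variance `|Stab|/(p! d)` is tuned so that, with the orbit coefficient `p!/|Stab|`
squared, each orbit has total weight `p!/(|Stab| d)`. Unfolding the orbits gives `‖g‖^(2p)/d`, as in
the other model. -/
theorem ModelS.hasDiagonalMoments {B : Ω → Tensor p d} (h : ModelS B μ) :
    HasDiagonalMoments B μ := by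
  obtain ⟨hsymm, hind, ν, hν, hγ, hvar, hlaw⟩ := h
  have hrig : ∀ I, IsRigidlySubGaussian (fun ω => B ω I) μ := fun I =>
    (hγ.const_mul _).of_identDistrib (hlaw I)
  have hvarI : ∀ I, ∫ ω, ‖B ω I‖ ^ 2 ∂μ = stabCard I / p.factorial * (1 / d) := fun I => by
    refine ((hlaw I).comp (u := fun z : ℂ => ‖z‖ ^ 2) (by fun_prop)).integral_eq.trans ?_
    simp only [Function.comp, norm_mul, mul_pow, integral_const_mul, hvar]
    rw [Complex.norm_real, Real.norm_eq_abs, sq_abs, Real.sq_sqrt (by positivity)]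
  have key := fun g : Fin d → ℂ => IsRigidlySubGaussian.sum_conj_mul
    (fun J : {I : Fin p → Fin d // Monotone I} => hrig J.1) hind
    fun J => (p.factorial : ℂ) / stabCard J.1 * ∏ k, g (J.1 k)
  have hae : ∀ g : Fin d → ℂ, (fun ω => pairing (B ω) fun _ => WithLp.toLp 2 g) =ᵐ[μ]
      fun ω => ∑ J : {I : Fin p → Fin d // Monotone I}, conj (B ω J.1) *
        ((p.factorial : ℂ) / stabCard J.1 * ∏ k, g (J.1 k)) := fun g => by
    filter_upwards [hsymm] with ω hω
    refine (sum_eq_sum_monotone (fun I => conj (B ω I) * ∏ k, g (I k)) fun σ I => ?_).trans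
      (Finset.sum_congr rfl fun J _ => by ring)
    simp only [hω σ I, prod_comp_perm]
  refine ⟨hsymm, aemeasurable_pi_iff.2 fun I => (hrig I).aemeasurable,
    fun I => (hrig I).integrable_norm, fun g => (key g).1.congr_ae (hae g), fun g => ?_⟩
  rw [integral_congr_ae ((hae g).mono fun ω hω => by simp only [hω]; rfl), (key g).2,
    ← sum_norm_sq_prod, ← Complex.ofReal_inj, Complex.ofReal_mul, Complex.ofReal_sum
      (f := fun I : Fin p → Fin d => ‖∏ k, g (I k)‖ ^ 2),
    sum_eq_sum_monotone _ fun σ I => by rw [prod_comp_perm], ← Complex.ofReal_natCast p.factorial]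
  rw [Complex.ofReal_sum, Finset.mul_sum]
  refine Finset.sum_congr rfl fun J _ => ?_
  rw [hvarI, norm_mul, norm_div, Complex.norm_natCast]
  have h1 : (stabCard J.1 : ℂ) ≠ 0 := by exact_mod_cast (stabCard_pos J.1).ne'
  have h2 : (p.factorial : ℂ) ≠ 0 := by exact_mod_cast Nat.factorial_ne_zero p
  push_cast
  rw [Complex.norm_natCast]
  push_cast
  field_simp

end

/-! ### The moment bound for the expected injective norm. -/

section

variable {p d : ℕ}

/-- The `k`-th power of the homogeneous polynomial attached to a tensor. -/
def powPoly (T : Tensor p d) (k : ℕ) : MvPolynomial (Fin d) ℂ :=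
  (∑ I : Fin p → Fin d, MvPolynomial.C (conj (T I)) * ∏ j, MvPolynomial.X (I j)) ^ k

theorem powPoly_isHomogeneous (T : Tensor p d) (k : ℕ) : (powPoly T k).IsHomogeneous (p * k) := by
  refine MvPolynomial.IsHomogeneous.pow (MvPolynomial.IsHomogeneous.sum _ _ _ fun I _ => ?_) k
  have h := (MvPolynomial.isHomogeneous_C (Fin d) (conj (T I))).mul
    (MvPolynomial.IsHomogeneous.prod Finset.univ (fun j => MvPolynomial.X (R := ℂ) (I j))
      (fun _ => 1) fun j _ => MvPolynomial.isHomogeneous_X ℂ (I j))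
  simpa using h

theorem eval_powPoly (T : Tensor p d) (k : ℕ) (g : Fin d → ℂ) :
    MvPolynomial.eval g (powPoly T k) = (pairing T fun _ => WithLp.toLp 2 g) ^ k := by
  simp [powPoly, pairing]

theorem norm_sq_eval_powPoly (T : Tensor p d) (k : ℕ) (g : Fin d → ℂ) :
    ‖MvPolynomial.eval g (powPoly T k)‖ ^ 2 = ‖pairing T fun _ => WithLp.toLp 2 g‖ ^ (2 * k) := by
  rw [eval_powPoly, norm_pow, ← pow_mul, mul_comm k]

/-- The injective norm of a symmetric tensor is controlled by its Gaussian diagonal moments. -/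
theorem IsSymm.injNorm_pow_le (hp : 1 ≤ p) (hd : 1 ≤ d) {T : Tensor p d} (hT : IsSymm T) (k : ℕ) :
    (p * k).factorial * injNorm T ^ (2 * k) ≤
      ∫ g, ‖pairing T fun _ => WithLp.toLp 2 g‖ ^ (2 * k) ∂(stdComplexGaussianPi d) := by
  obtain ⟨x, hx, hinj⟩ := hT.exists_injNorm_eq hp hd
  have h := norm_sq_eval_le (powPoly_isHomogeneous T k) x
  simp only [norm_sq_eval_powPoly] at h
  rw [← EuclideanSpace.norm_sq_eq x, hx, one_pow, one_pow, one_mul] at h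
  rw [hinj]
  exact h

/-- Joint continuity gives the joint measurability needed for Tonelli's theorem. -/
theorem continuous_pairing_toLp :
    Continuous fun q : Tensor p d × (Fin d → ℂ) => pairing q.1 fun _ => WithLp.toLp 2 q.2 := by
  unfold pairing
  fun_prop

variable {Ω : Type*} [MeasurableSpace Ω] {μ : Measure Ω}

theorem HasDiagonalMoments.integrable_injNorm (hd : 1 ≤ d) {B : Ω → Tensor p d}
    (h : HasDiagonalMoments B μ) : Integrable (fun ω => injNorm (B ω)) μ := by
  refine (integrable_finsetSum Finset.univ fun I _ => h.integrable I).mono'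
    ((continuous_injNorm hd).measurable.comp_aemeasurable h.aemeasurable).aestronglyMeasurable
    (Eventually.of_forall fun ω => ?_)
  rw [Real.norm_of_nonneg (injNorm_nonneg _)]
  exact injNorm_le_sum hd _

variable [IsProbabilityMeasure μ]

/-- Stated with lower integrals because integrability of `injNorm ^ (2 * k)` is not yet known; it is
deduced from the finiteness of this bound. -/
theorem HasDiagonalMoments.lintegral_injNorm_pow_le (hp : 1 ≤ p) (hd : 1 ≤ d)
    {B : Ω → Tensor p d} (h : HasDiagonalMoments B μ) (k : ℕ) :
    ∫⁻ ω, ENNReal.ofReal ((p * k).factorial * injNorm (B ω) ^ (2 * k)) ∂μ ≤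
      ENNReal.ofReal (k.factorial / (d : ℝ) ^ k *
        ((p * k).factorial * ((p * k + d - 1).choose (d - 1) : ℝ))) := by
  have hmeas : AEMeasurable (Function.uncurry fun (ω : Ω) (g : Fin d → ℂ) =>
      ENNReal.ofReal (‖pairing (B ω) fun _ => WithLp.toLp 2 g‖ ^ (2 * k)))
      (μ.prod (stdComplexGaussianPi d)) := by
    have h1 : Measurable fun q : Tensor p d × (Fin d → ℂ) =>
        ENNReal.ofReal (‖pairing q.1 fun _ => WithLp.toLp 2 q.2‖ ^ (2 * k)) :=
      ENNReal.measurable_ofReal.comp (continuous_pairing_toLp.norm.pow _).measurable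
    have h2 : AEMeasurable (fun q : Ω × (Fin d → ℂ) => (B q.1, q.2))
        (μ.prod (stdComplexGaussianPi d)) := by
      refine AEMeasurable.prodMk ?_ measurable_snd.aemeasurable
      exact h.aemeasurable.comp_fst
    have h3 := h1.comp_aemeasurable h2
    simp only [Function.comp_def] at h3
    simp only [Function.uncurry_def]
    exact h3
  calc ∫⁻ ω, ENNReal.ofReal ((p * k).factorial * injNorm (B ω) ^ (2 * k)) ∂μ
      ≤ ∫⁻ ω, ∫⁻ g, ENNReal.ofReal (‖pairing (B ω) fun _ => WithLp.toLp 2 g‖ ^ (2 * k))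
          ∂(stdComplexGaussianPi d) ∂μ := by
        refine lintegral_mono_ae (h.symm.mono fun ω hω => ?_)
        rw [← ofReal_integral_eq_lintegral_ofReal]
        · exact ENNReal.ofReal_le_ofReal (hω.injNorm_pow_le hp hd k)
        · simpa only [norm_sq_eval_powPoly] using integrable_norm_sq_eval (powPoly (B ω) k)
        · exact Eventually.of_forall fun _ => by positivity
    _ = ∫⁻ g, ∫⁻ ω, ENNReal.ofReal (‖pairing (B ω) fun _ => WithLp.toLp 2 g‖ ^ (2 * k))
          ∂μ ∂(stdComplexGaussianPi d) := lintegral_lintegral_swap hmeas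
    _ ≤ ∫⁻ g, ENNReal.ofReal (k.factorial / (d : ℝ) ^ k * (∑ i, ‖g i‖ ^ 2) ^ (p * k))
          ∂(stdComplexGaussianPi d) := by
        refine lintegral_mono fun g => ?_
        rw [← ofReal_integral_eq_lintegral_ofReal ((h.rigid g).integrable_pow k)
          (Eventually.of_forall fun _ => by positivity)]
        refine ENNReal.ofReal_le_ofReal (((h.rigid g).moment_le k).trans_eq ?_)
        rw [h.variance, mul_pow, ← pow_mul, one_div, inv_pow]
        ring
    _ = _ := by
        rw [← ofReal_integral_eq_lintegral_ofReal ((integrable_norm_sq_pow _).const_mul _)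
          (Eventually.of_forall fun _ => by positivity), integral_const_mul,
          integral_norm_sq_pow hd]

/-- The basic moment bound for the expected injective norm. -/
theorem HasDiagonalMoments.integral_injNorm_pow_le (hp : 1 ≤ p) (hd : 1 ≤ d)
    {B : Ω → Tensor p d} (h : HasDiagonalMoments B μ) (k : ℕ) :
    (∫ ω, injNorm (B ω) ∂μ) ^ (2 * k) ≤
      ((p * k + d - 1).choose (d - 1) : ℝ) * k.factorial / (d : ℝ) ^ k := by
  have hfac : (0 : ℝ) < (p * k).factorial := by positivity
  have hle := h.lintegral_injNorm_pow_le hp hd k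
  have hnn : ∀ ω, 0 ≤ (p * k).factorial * injNorm (B ω) ^ (2 * k) := fun ω =>
    mul_nonneg hfac.le (pow_nonneg (injNorm_nonneg _) _)
  have hmeas : AEStronglyMeasurable (fun ω => (p * k).factorial * injNorm (B ω) ^ (2 * k)) μ :=
    (((h.integrable_injNorm hd).aestronglyMeasurable.pow _).const_mul _)
  have hint : Integrable (fun ω => (p * k).factorial * injNorm (B ω) ^ (2 * k)) μ :=
    ⟨hmeas, (hasFiniteIntegral_iff_ofReal (Eventually.of_forall hnn)).2
      (hle.trans_lt ENNReal.ofReal_lt_top)⟩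
  rw [← ofReal_integral_eq_lintegral_ofReal hint (Eventually.of_forall hnn),
    ENNReal.ofReal_le_ofReal_iff (by positivity), integral_const_mul] at hle
  have hint' : Integrable (fun ω => injNorm (B ω) ^ (2 * k)) μ := by
    simpa [hfac.ne'] using hint.const_mul ((p * k).factorial : ℝ)⁻¹
  -- Jensen for `t ↦ t^(2k)` on `[0, ∞)`; the factor `(pk)!` then cancels from both sides.
  have hJ := (convexOn_pow (2 * k)).map_integral_le (by fun_prop) isClosed_Ici
    (Eventually.of_forall fun ω => injNorm_nonneg (B ω)) (h.integrable_injNorm hd) hint'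
  refine hJ.trans (le_of_mul_le_mul_left (hle.trans_eq ?_) hfac)
  ring

end

/-! ### From moments to explicit bounds, and the limit `d → ∞`. -/

section

/-- This is `k! ≤ e √k (k/e)^k`: Stirling's sequence is decreasing from `k = 1` on. -/
theorem factorial_le_exp {k : ℕ} (hk : 1 ≤ k) :
    (k.factorial : ℝ) ≤ Real.exp (1 + 1 / 2 * Real.log k + (k * Real.log k - k)) := by
  have hk0 : (0 : ℝ) < k := by exact_mod_cast hk
  have h := Stirling.stirlingSeq'_antitone (Nat.zero_le (k - 1))
  simp only [Function.comp, Nat.succ_eq_add_one, Nat.sub_add_cancel hk, zero_add,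
    Stirling.stirlingSeq_one] at h
  rw [Stirling.stirlingSeq, div_le_iff₀ (by positivity)] at h
  refine h.trans_eq ?_
  have h2 : Real.exp (1 / 2 * Real.log k) = √k := by
    rw [Real.sqrt_eq_rpow, Real.rpow_def_of_pos hk0, mul_comm]
  rw [Real.exp_add, Real.exp_add, Real.exp_sub, h2, Real.exp_nat_mul, Real.exp_log hk0, div_pow,
    ← Real.exp_nat_mul, mul_one, Real.sqrt_mul (by norm_num)]
  field_simp

/-- One term of the binomial expansion of `(m + n)^(n + m)` is at most the whole sum. -/
theorem log_choose_le {n m : ℕ} (hn : 1 ≤ n) (hm : 1 ≤ m) :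
    Real.log ((n + m).choose m) ≤
      (n + m) * Real.log (n + m) - n * Real.log n - m * Real.log m := by
  have hn0 : (0 : ℝ) < n := by exact_mod_cast hn
  have hm0 : (0 : ℝ) < m := by exact_mod_cast hm
  have h : (n : ℝ) ^ n * (m : ℝ) ^ m * ((n + m).choose m) ≤ ((n : ℝ) + m) ^ (n + m) := by
    rw [add_comm (n : ℝ), add_pow]
    refine (le_of_eq ?_).trans (Finset.single_le_sum (f := fun i => (m : ℝ) ^ i *
      (n : ℝ) ^ (n + m - i) * ((n + m).choose i : ℝ)) (fun i _ => by positivity)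
      (Finset.mem_range.2 (by omega : m < n + m + 1)))
    simp only [Nat.add_sub_cancel]
    ring
  have hc : (0 : ℝ) < ((n + m).choose m) := by
    exact_mod_cast Nat.choose_pos (Nat.le_add_left m n)
  have h2 := Real.log_le_log (by positivity) h
  rw [Real.log_mul (by positivity) hc.ne', Real.log_mul (by positivity) (by positivity),
    Real.log_pow, Real.log_pow, Real.log_pow] at h2
  push_cast at h2
  linarith

theorem le_exp_of_pow_le {E X : ℝ} {k : ℕ} (hk : 1 ≤ k)
    (h : E ^ (2 * k) ≤ Real.exp X) : E ≤ Real.exp (X / (2 * k)) := by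
  have hk0 : (k : ℝ) ≠ 0 := by exact_mod_cast (by omega : k ≠ 0)
  refine le_of_pow_le_pow_left₀ (n := 2 * k) (by omega) (Real.exp_pos _).le (h.trans_eq ?_)
  rw [← Real.exp_nat_mul]
  congr 1
  push_cast
  field_simp

/-- The logarithm of the square of `phi`. -/
def logPhiSq (p : ℕ) (α : ℝ) : ℝ :=
  -(p * Real.log p) - 1 - (α + 1) * Real.log α + (p + α) * Real.log (p + α)

theorem phi_eq_exp {p : ℕ} (hp : 1 ≤ p) {α : ℝ} (hα : 0 < α) :
    phi p α = Real.exp (1 / 2 * logPhiSq p α) := by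
  have hp0 : (0 : ℝ) < p := by exact_mod_cast hp
  rw [phi, Real.rpow_def_of_pos hp0, Real.rpow_def_of_pos hα, Real.rpow_def_of_pos (by positivity),
    ← Real.exp_half, ← Real.exp_add, one_div, ← Real.exp_neg, ← Real.exp_add, ← Real.exp_add,
    logPhiSq]
  congr 1
  ring

theorem phi_nonneg (p : ℕ) {α : ℝ} (hα : 0 < α) : 0 ≤ phi p α := by
  unfold phi; positivity

/-- The number `E` obeys the moment bounds satisfied by the expected injective norm. -/
def MomentBound (p d : ℕ) (E : ℝ) : Prop :=
  ∀ k : ℕ, E ^ (2 * k) ≤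
    ((p * k + d - 1).choose (d - 1) : ℝ) * k.factorial / (d : ℝ) ^ k

/-- With `α = d / k`, the entropy bound on the binomial and Stirling's bound combine to
`φ_p(α)^(2k)`, up to the factor `e √k`, whose `2k`-th root tends to `1`. -/
theorem MomentBound.le_phi_mul {p d : ℕ} {E : ℝ} (hE : MomentBound p d E) (hp : 1 ≤ p)
    (hd : 1 ≤ d) {k : ℕ} (hk : 1 ≤ k) :
    E ≤ Real.exp (1 / 2 * logPhiSq p (d / k) + (1 + 1 / 2 * Real.log k) / (2 * k)) := by
  have hp0 : (0 : ℝ) < p := by exact_mod_cast hp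
  have hd0 : (0 : ℝ) < d := by exact_mod_cast hd
  have hk0 : (0 : ℝ) < k := by exact_mod_cast hk
  have hpk : 1 ≤ p * k := Nat.mul_pos hp hk
  -- Pascal's rule: the larger binomial is the one whose entropy bound has exactly the form of
  -- `logPhiSq`.
  have hch : ((p * k + d - 1).choose (d - 1) : ℝ) ≤ ((p * k + d).choose d : ℝ) := by
    have h : (p * k + d - 1 + 1).choose (d - 1 + 1) = _ := Nat.choose_succ_succ _ _
    rw [Nat.sub_add_cancel hd, Nat.sub_add_cancel (by omega)] at h
    exact_mod_cast h ▸ Nat.le_add_right _ _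
  have hcpos : (0 : ℝ) < ((p * k + d).choose d : ℝ) := by
    exact_mod_cast Nat.choose_pos (Nat.le_add_left _ _)
  have hlog := log_choose_le hpk hd
  have hmain : E ^ (2 * k) ≤ Real.exp (((p * k : ℕ) + d) * Real.log ((p * k : ℕ) + d) -
      (p * k : ℕ) * Real.log (p * k : ℕ) - d * Real.log d +
      (1 + 1 / 2 * Real.log k + (k * Real.log k - k)) - k * Real.log d) := by
    refine (hE k).trans ?_
    rw [Real.exp_sub, Real.exp_add, Real.exp_nat_mul, Real.exp_log hd0]
    gcongr
    · exact hch.trans ((Real.exp_log hcpos).symm.le.trans (Real.exp_le_exp.2 hlog))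
    · exact factorial_le_exp hk
  refine (le_exp_of_pow_le hk hmain).trans_eq ?_
  congr 1
  have e1 : ((p * k : ℕ) + d : ℝ) = k * (p + d / k) := by push_cast; field_simp
  rw [e1, Real.log_mul hk0.ne' (by positivity)]
  push_cast
  rw [Real.log_mul hp0.ne' hk0.ne', logPhiSq, Real.log_div hd0.ne' hk0.ne']
  field_simp
  ring

/-- The binomial is at most `(d p k)^(d-1)`, and the condition on `k` lets `exp (-k)` from
Stirling's bound absorb `p^(d-1)`. -/
theorem MomentBound.le_of_log_le {p d : ℕ} {E : ℝ} (hE : MomentBound p d E) (hp : 1 ≤ p)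
    (hd : 1 ≤ d) {k : ℕ} (hk : 1 ≤ k) (hlog : ((d : ℝ) - 1) * Real.log p ≤ k) :
    E ≤ Real.exp (1 / 2 * Real.log k - 1 / 2 * Real.log d +
      (1 + (d - 1) * Real.log d + (d - 1 / 2) * Real.log k) / (2 * k)) := by
  have hp0 : (0 : ℝ) < p := by exact_mod_cast hp
  have hd0 : (0 : ℝ) < d := by exact_mod_cast hd
  have hk0 : (0 : ℝ) < k := by exact_mod_cast hk
  have hch : ((p * k + d - 1).choose (d - 1) : ℝ) ≤
      Real.exp ((d - 1) * (Real.log d + Real.log p + Real.log k)) := by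
    have h1 : (p * k + d - 1).choose (d - 1) ≤ (d * p * k) ^ (d - 1) := by
      refine (Nat.choose_le_pow _ _).trans (Nat.pow_le_pow_left ?_ _)
      have : 1 ≤ p * k := Nat.mul_pos hp hk
      have h2 : p * k + d ≤ d * (p * k) + 1 := by nlinarith
      rw [mul_assoc]; omega
    have h2 : ((p * k + d - 1).choose (d - 1) : ℝ) ≤ ((d : ℝ) * p * k) ^ (d - 1) := by
      exact_mod_cast h1
    refine h2.trans_eq ?_
    rw [← Real.log_mul hd0.ne' hp0.ne', ← Real.log_mul (by positivity) hk0.ne']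
    have : (d : ℝ) - 1 = ((d - 1 : ℕ) : ℝ) := by push_cast [hd]; ring
    rw [this, Real.exp_nat_mul, Real.exp_log (by positivity)]
  have hmain : E ^ (2 * k) ≤ Real.exp ((d - 1) * (Real.log d + Real.log p + Real.log k) +
      (1 + 1 / 2 * Real.log k + (k * Real.log k - k)) - k * Real.log d) := by
    refine (hE k).trans ?_
    rw [Real.exp_sub, Real.exp_add, Real.exp_nat_mul, Real.exp_log hd0]
    gcongr
    exact factorial_le_exp hk
  refine (le_exp_of_pow_le hk hmain).trans (Real.exp_le_exp.2 ?_)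
  have e : 1 / 2 * Real.log k - 1 / 2 * Real.log d +
      (1 + (d - 1) * Real.log d + (d - 1 / 2) * Real.log k) / (2 * k) =
      (k * Real.log k - k * Real.log d + (1 + (d - 1) * Real.log d + (d - 1 / 2) * Real.log k)) /
        (2 * k) := by field_simp
  rw [e]
  gcongr
  linarith

/-- The limiting bound with `p` fixed. -/
theorem limsup_le_phi {p : ℕ} (hp : 1 ≤ p) {E : ℕ → ℝ}
    (hE : ∀ d, 1 ≤ d → MomentBound p d (E d)) {α : ℝ} (hα : 0 < α) :
    limsup (fun d : ℕ => ((E d : ℝ) : EReal)) atTop ≤ ((phi p α : ℝ) : EReal) := by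
  -- This choice makes `k → ∞` and `d / k → α`.
  set k : ℕ → ℕ := fun d => ⌈(d : ℝ) / α⌉₊ with hk
  have hkt : Tendsto (fun d => (k d : ℝ)) atTop atTop := by
    refine tendsto_atTop_mono (fun d => Nat.le_ceil _) ?_
    exact tendsto_natCast_atTop_atTop.atTop_div_const hα
  have hdt : Tendsto (fun d : ℕ => (d : ℝ) / k d) atTop (𝓝 α) := by
    have h1 : Tendsto (fun d : ℕ => (d : ℝ) / α) atTop atTop :=
      tendsto_natCast_atTop_atTop.atTop_div_const hα
    have h2 : Tendsto (fun d : ℕ => ((k d : ℝ)) / ((d : ℝ) / α)) atTop (𝓝 1) :=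
      (tendsto_nat_ceil_div_atTop (R := ℝ)).comp h1
    have h3 := (h2.inv₀ one_ne_zero).const_mul α
    rw [inv_one, mul_one] at h3
    refine h3.congr' ?_
    filter_upwards with d
    rw [inv_div]
    field_simp
  have hlog : Tendsto (fun d => (1 + 1 / 2 * Real.log (k d)) / (2 * k d)) atTop (𝓝 0) := by
    have h1 : Tendsto (fun x : ℝ => (1 + 1 / 2 * Real.log x) / (2 * x)) atTop (𝓝 0) := by
      have h2 := (Real.isLittleO_log_id_atTop.tendsto_div_nhds_zero.const_mul (1 / 4 : ℝ)).add
        (tendsto_inv_atTop_zero.const_mul (1 / 2 : ℝ))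
      simp only [mul_zero, add_zero] at h2
      refine h2.congr' ?_
      filter_upwards [eventually_gt_atTop 0] with x hx
      simp only [id]
      field_simp
      ring
    exact h1.comp hkt
  have hψ : ContinuousAt (logPhiSq p) α := by
    unfold logPhiSq
    have : (p : ℝ) + α ≠ 0 := by positivity
    fun_prop (disch := first | exact hα.ne' | assumption)
  have hlim : Tendsto (fun d : ℕ => Real.exp (1 / 2 * logPhiSq p (d / k d) +
      (1 + 1 / 2 * Real.log (k d)) / (2 * k d))) atTop (𝓝 (phi p α)) := by
    rw [phi_eq_exp hp hα]
    have := (Real.continuous_exp.tendsto _).comp (((hψ.tendsto.comp hdt).const_mul (1 / 2)).add hlog)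
    rw [add_zero] at this
    exact this
  have hlimE := (continuous_coe_real_ereal.tendsto _).comp hlim
  rw [← hlimE.limsup_eq]
  refine limsup_le_limsup ?_
  filter_upwards [eventually_ge_atTop 1] with d hd
  refine EReal.coe_le_coe_iff.2 ((hE d hd).le_phi_mul hp hd ?_)
  rw [hk]
  refine Nat.ceil_pos.2 (div_pos (by exact_mod_cast hd) hα)

theorem limsup_le_iInf_phi {p : ℕ} (hp : 1 ≤ p) {E : ℕ → ℝ}
    (hE : ∀ d, 1 ≤ d → MomentBound p d (E d)) :
    limsup (fun d : ℕ => ((E d : ℝ) : EReal)) atTop ≤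
      ((⨅ α : Set.Ioi (0 : ℝ), phi p α : ℝ) : EReal) := by
  have : Nonempty (Set.Ioi (0 : ℝ)) := ⟨⟨1, Set.mem_Ioi.2 one_pos⟩⟩
  have hbdd : BddBelow (Set.range fun α : Set.Ioi (0 : ℝ) => phi p α) :=
    ⟨0, by rintro _ ⟨α, rfl⟩; exact phi_nonneg p α.2⟩
  refine EReal.le_of_forall_lt_iff_le.1 fun z hz => ?_
  obtain ⟨α, hα⟩ := exists_lt_of_ciInf_lt (EReal.coe_lt_coe_iff.1 hz)
  exact (limsup_le_phi hp hE α.2).trans (EReal.coe_le_coe_iff.2 hα.le)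

end

/-! ### The limit `p → ∞` with `d` fixed, and its rate. -/

section

/-- Take `k = ⌈(d-1) log p⌉`. The main term `√(k/d)` yields the factor `√((d-1)/d)` after division
by `√(log p)`; the exponential collects the rounding error and the lower-order terms. -/
theorem MomentBound.div_sqrt_log_le {p d : ℕ} {E : ℝ} (hE : MomentBound p d E) (hp : 1 ≤ p)
    (hd : 2 ≤ d) (hlog : 1 ≤ Real.log p) :
    1 / √(Real.log p) * E ≤ √(((d : ℝ) - 1) / d) *
      Real.exp ((2 + (d - 1) * Real.log d + (d - 1 / 2) * Real.log d +
        (d - 1 / 2) * Real.log (Real.log p)) / (2 * ((d - 1) * Real.log p))) := by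
  have hd0 : (2 : ℝ) ≤ d := by exact_mod_cast hd
  have hd1 : (0 : ℝ) < d - 1 := by linarith
  have hd' : (0 : ℝ) < d := by linarith
  have hy : 0 < Real.log p := by linarith
  set y := Real.log p with hydef
  set L := ((d : ℝ) - 1) * y with hL
  have hL0 : 0 < L := mul_pos hd1 hy
  set k := ⌈L⌉₊ with hk
  have hk1 : 1 ≤ k := Nat.ceil_pos.2 hL0
  have hk0 : (0 : ℝ) < k := by exact_mod_cast hk1
  have hLk : L ≤ k := Nat.le_ceil L
  have hkL : (k : ℝ) ≤ L + 1 := (Nat.ceil_lt_add_one hL0.le).le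
  have h := hE.le_of_log_le hp (by omega) hk1 hLk
  have hlogd : 0 ≤ Real.log d := Real.log_nonneg (by linarith)
  have hlogk : 0 ≤ Real.log k := Real.log_nonneg (by exact_mod_cast hk1)
  have hk2 : Real.log k ≤ Real.log L + 1 / L := by
    have h1 : Real.log k ≤ Real.log (L * (1 + 1 / L)) :=
      Real.log_le_log hk0 (hkL.trans_eq (by field_simp))
    rw [Real.log_mul hL0.ne' (by positivity)] at h1
    have h2 := Real.log_le_sub_one_of_pos (by positivity : 0 < 1 + 1 / L)
    linarith
  -- Since `log p ≥ 1`, rounding up costs at most `log p`, so `k ≤ d log p`.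
  have hk3 : Real.log k ≤ Real.log d + Real.log y := by
    rw [← Real.log_mul hd'.ne' hy.ne']
    refine Real.log_le_log hk0 (hkL.trans ?_)
    rw [hL]; linarith
  have hsy : √y = Real.exp (1 / 2 * Real.log y) := by
    rw [Real.sqrt_eq_rpow, Real.rpow_def_of_pos hy, mul_comm]
  have hsd : √(((d : ℝ) - 1) / d) = Real.exp (1 / 2 * (Real.log (d - 1) - Real.log d)) := by
    rw [Real.sqrt_eq_rpow, Real.rpow_def_of_pos (by positivity), mul_comm,
      Real.log_div hd1.ne' hd'.ne']
  rw [hsy, hsd, one_div, ← Real.exp_neg, ← Real.exp_add]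
  refine (mul_le_mul_of_nonneg_left h (Real.exp_pos _).le).trans ?_
  rw [← Real.exp_add]
  refine Real.exp_le_exp.2 ?_
  have hLl : Real.log L = Real.log (d - 1) + Real.log y := by rw [hL, Real.log_mul hd1.ne' hy.ne']
  have hq : (1 + (d - 1) * Real.log d + (d - 1 / 2) * Real.log k) / (2 * k) ≤
      (1 + (d - 1) * Real.log d + (d - 1 / 2) * (Real.log d + Real.log y)) / (2 * L) := by
    have hd2 : (0 : ℝ) ≤ d - 1 / 2 := by linarith
    have hlogy : 0 ≤ Real.log y := Real.log_nonneg hlog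
    gcongr
  have e : (2 + (d - 1) * Real.log d + (d - 1 / 2) * Real.log d + (d - 1 / 2) * Real.log y) /
      (2 * L) = (1 + (d - 1) * Real.log d + (d - 1 / 2) * (Real.log d + Real.log y)) / (2 * L) +
        1 / 2 * (1 / L) := by field_simp; ring
  rw [e]
  linarith

theorem tendsto_log_log_div_log :
    Tendsto (fun p : ℕ => Real.log (Real.log p) / Real.log p) atTop (𝓝 0) :=
  (Real.isLittleO_log_id_atTop.tendsto_div_nhds_zero.comp Real.tendsto_log_atTop).comp
    tendsto_natCast_atTop_atTop

theorem eventually_exp_le {c C b ε : ℝ} (hc : 0 < c) (hb : 0 < b) (hε : 0 < ε) :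
    ∀ᶠ p : ℕ in atTop, Real.exp ((C + c * Real.log (Real.log p)) / (b * Real.log p)) ≤
      1 + (1 + ε) * (c / b) * (Real.log (Real.log p) / Real.log p) := by
  -- Two factors `1 + δ` have to fit into `1 + ε`: one absorbs the constant `C` into `c log log p`,
  -- the other the quadratic term of `exp t ≤ 1 + t (1 + t)`.
  set δ := min (ε / 3) 1 with hδ
  have hδ0 : 0 < δ := lt_min (by positivity) one_pos
  have hδ1 : δ ≤ 1 := min_le_right _ _
  have hδε : (1 + δ) * (1 + δ) ≤ 1 + ε := by
    have : δ ≤ ε / 3 := min_le_left _ _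
    nlinarith
  have hlog : Tendsto (fun p : ℕ => Real.log p) atTop atTop :=
    Real.tendsto_log_atTop.comp tendsto_natCast_atTop_atTop
  have hloglog := Real.tendsto_log_atTop.comp hlog
  have hsmall := (tendsto_log_log_div_log.const_mul ((1 + δ) * (c / b))).eventually_le_const
    (by rw [mul_zero]; exact hδ0 : (1 + δ) * (c / b) * 0 < δ)
  filter_upwards [hlog.eventually_ge_atTop 1, hloglog.eventually_ge_atTop (|C| / (δ * c)), hsmall]
    with p hy hℓ hs
  simp only [Function.comp] at hℓ
  set y := Real.log p
  set ℓ := Real.log y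
  have hy0 : 0 < y := by linarith
  have hℓ0 : 0 ≤ ℓ := Real.log_nonneg hy
  rw [div_le_iff₀ (by positivity)] at hℓ
  set t := (C + c * ℓ) / (b * y) with ht
  have hC : |C| ≤ δ * c * ℓ := by linarith
  have ht1 : t ≤ (1 + δ) * (c / b) * (ℓ / y) := by
    have e : (1 + δ) * (c / b) * (ℓ / y) = (δ * c * ℓ + c * ℓ) / (b * y) := by
      field_simp
      ring
    rw [e, ht]
    gcongr
    exact (le_abs_self C).trans hC
  have ht0 : 0 ≤ t := by
    refine div_nonneg ?_ (by positivity)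
    have : δ * c * ℓ ≤ c * ℓ := by
      rw [mul_assoc]; exact mul_le_of_le_one_left (by positivity) hδ1
    linarith [neg_abs_le C]
  have htδ : t ≤ δ := ht1.trans hs
  have hexp := Real.abs_exp_sub_one_sub_id_le (x := t) (by rw [abs_of_nonneg ht0]; linarith)
  have h1 : Real.exp t ≤ 1 + t * (1 + t) := by nlinarith [(abs_le.1 hexp).2]
  have hm : 0 ≤ c / b * (ℓ / y) := by positivity
  calc Real.exp t ≤ 1 + t * (1 + t) := h1
    _ ≤ 1 + ((1 + δ) * (c / b) * (ℓ / y)) * (1 + δ) := by gcongr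
    _ = 1 + (1 + δ) * (1 + δ) * (c / b * (ℓ / y)) := by ring
    _ ≤ 1 + (1 + ε) * (c / b * (ℓ / y)) := by gcongr
    _ = _ := by ring

theorem exists_rate {d : ℕ} (hd : 2 ≤ d) {ε : ℝ} (hε : 0 < ε) :
    ∃ p₀ : ℕ, ∀ p : ℕ, p₀ ≤ p → 1 ≤ p → ∀ E : ℝ, MomentBound p d E →
      1 / √(Real.log p) * E ≤ √(((d : ℝ) - 1) / d) *
        (1 + (1 + ε) * ((2 * (d : ℝ) - 1) / (4 * (d : ℝ) - 4)) *
          (Real.log (Real.log p) / Real.log p)) := by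
  have hd0 : (2 : ℝ) ≤ d := by exact_mod_cast hd
  have hd1 : (0 : ℝ) < d - 1 := by linarith
  have hlog : Tendsto (fun p : ℕ => Real.log p) atTop atTop :=
    Real.tendsto_log_atTop.comp tendsto_natCast_atTop_atTop
  obtain ⟨p₀, hp₀⟩ := eventually_atTop.1 ((eventually_exp_le (c := d - 1 / 2)
    (C := 2 + (d - 1) * Real.log d + (d - 1 / 2) * Real.log d) (b := 2 * (d - 1)) (ε := ε)
    (by linarith) (by linarith) hε).and (hlog.eventually_ge_atTop 1))
  refine ⟨p₀, fun p hp hp1 E hE => (hE.div_sqrt_log_le hp1 hd (hp₀ p hp).2).trans ?_⟩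
  refine mul_le_mul_of_nonneg_left ?_ (Real.sqrt_nonneg _)
  have h := (hp₀ p hp).1
  have e : ((d : ℝ) - 1 / 2) / (2 * (d - 1)) = (2 * (d : ℝ) - 1) / (4 * (d : ℝ) - 4) := by
    rw [div_eq_div_iff (by linarith) (by linarith)]
    ring
  rw [← mul_assoc 2, ← e]
  exact h

theorem limsup_div_sqrt_log_le {d : ℕ} (hd : 1 ≤ d) {E : ℕ → ℝ}
    (hE : ∀ p, 1 ≤ p → MomentBound p d (E p)) :
    limsup (fun p : ℕ => ((1 / √(Real.log p) * E p : ℝ) : EReal)) atTop ≤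
      ((√(((d : ℝ) - 1) / d) : ℝ) : EReal) := by
  have key : ∀ u : ℕ → ℝ, (∀ᶠ p : ℕ in atTop, 1 / √(Real.log p) * E p ≤ u p) →
      Tendsto u atTop (𝓝 √(((d : ℝ) - 1) / d)) →
      limsup (fun p : ℕ => ((1 / √(Real.log p) * E p : ℝ) : EReal)) atTop ≤
        ((√(((d : ℝ) - 1) / d) : ℝ) : EReal) := fun u hu hlim => by
    rw [← ((continuous_coe_real_ereal.tendsto _).comp hlim).limsup_eq]
    exact limsup_le_limsup (hu.mono fun p hp => EReal.coe_le_coe_iff.2 hp)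
  -- For `d = 1` the rate degenerates, as `4d - 4 = 0`. There the binomial is `1`, and the moment
  -- bound with `k = 1` gives `E ≤ 1`, so the quotient tends to `0`.
  rcases hd.eq_or_lt with rfl | hd2
  · refine key (fun p => 1 / √(Real.log p)) ?_ ?_
    · filter_upwards [eventually_ge_atTop 1] with p hp
      have h := hE p hp 1
      simp only [Nat.sub_self, Nat.choose_zero_right, Nat.factorial_one, Nat.cast_one,
        one_pow, mul_one, div_one] at h
      refine mul_le_of_le_one_right (by positivity) ?_
      nlinarith
    · have h : Tendsto (fun p : ℕ => √(Real.log p)) atTop atTop :=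
        Real.tendsto_sqrt_atTop.comp
          (Real.tendsto_log_atTop.comp tendsto_natCast_atTop_atTop)
      simpa [Pi.inv_def] using h.inv_tendsto_atTop
  · obtain ⟨p₀, hp₀⟩ := exists_rate (d := d) hd2 one_pos
    refine key (fun p => √(((d : ℝ) - 1) / d) *
        (1 + (1 + 1) * ((2 * (d : ℝ) - 1) / (4 * (d : ℝ) - 4)) *
          (Real.log (Real.log p) / Real.log p))) ?_ ?_
    · filter_upwards [eventually_ge_atTop 1, eventually_ge_atTop p₀] with p hp hp'
      exact hp₀ p hp' hp _ (hE p hp)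
    · simpa using ((tendsto_log_log_div_log.const_mul _).const_add 1).const_mul
        √(((d : ℝ) - 1) / d)

/-! ### The minimiser of `φ_p` and its asymptotics. -/

/-- The sign of `log (1 + p u) - u` changes exactly once on the positive half-line. -/
theorem exists_log_one_add_mul_eq {p : ℕ} (hp : 2 ≤ p) :
    ∃ u₀ : ℝ, 0 < u₀ ∧ (∀ u, 0 < u → u < u₀ → u < Real.log (1 + p * u)) ∧
      ∀ u, u₀ < u → Real.log (1 + p * u) < u := by
  have hp0 : (2 : ℝ) ≤ p := by exact_mod_cast hp
  -- At this point `log (3/2) ≥ 1/3 > 1/4 ≥ u₁`, so the difference is nonnegative.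
  set u₁ : ℝ := 1 / (2 * p) with hu₁
  have hu₁0 : 0 < u₁ := by positivity
  have h1 : 0 ≤ Real.log (1 + p * u₁) - u₁ := by
    have e : (p : ℝ) * u₁ = 1 / 2 := by rw [hu₁]; field_simp
    have h2 := Real.one_sub_inv_le_log_of_pos (by norm_num : (0 : ℝ) < 1 + 1 / 2)
    have h3 : u₁ ≤ 1 / 4 := by
      rw [hu₁]; exact one_div_le_one_div_of_le (by norm_num) (by linarith)
    rw [e]
    norm_num at h2 ⊢
    linarith
  obtain ⟨u₂, hu₂, hu₁₂⟩ : ∃ u₂, Real.log (1 + p * u₂) - u₂ ≤ 0 ∧ u₁ ≤ u₂ := by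
    -- Here `log (1 + 4p²) ≤ 2 log (1 + 2p) ≤ 4p`.
    refine ⟨4 * p, ?_, ?_⟩
    · have h3 : Real.log (1 + p * (4 * p)) ≤ 2 * Real.log (1 + 2 * p) := by
        rw [← Real.log_rpow (by positivity)]
        refine Real.log_le_log (by positivity) ?_
        rw [Real.rpow_two]; nlinarith
      have h4 := Real.log_le_sub_one_of_pos (by positivity : (0 : ℝ) < 1 + 2 * p)
      linarith
    · have : u₁ ≤ 1 := by
        rw [hu₁, div_le_one (by positivity)]; linarith
      linarith
  have hcont : ContinuousOn (fun u : ℝ => Real.log (1 + p * u) - u) (Set.Icc u₁ u₂) := by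
    refine ContinuousOn.sub (ContinuousOn.log (by fun_prop) fun u hu => ?_) continuousOn_id
    have : 0 < u := hu₁0.trans_le hu.1
    positivity
  obtain ⟨u₀, hu₀, hzero⟩ := intermediate_value_Icc' hu₁₂ hcont ⟨hu₂, h1⟩
  have hu₀0 : 0 < u₀ := hu₁0.trans_le hu₀.1
  have hzero : Real.log (1 + p * u₀) = u₀ := sub_eq_zero.1 hzero
  -- Strict concavity of `log` on the chord from `1` to `1 + p v`; comparison with the zero `u₀`
  -- fixes the sign on either side.
  have hconc : ∀ u v : ℝ, 0 < u → u < v → u / v * Real.log (1 + p * v) < Real.log (1 + p * u) := by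
    intro u v hu huv
    have hv : 0 < v := hu.trans huv
    have hpv : 0 < p * v := by positivity
    have h := strictConcaveOn_log_Ioi.2 (Set.mem_Ioi.2 one_pos)
      (Set.mem_Ioi.2 (by positivity : 0 < 1 + p * v)) (by linarith)
      (sub_pos.2 ((div_lt_one hv).2 huv)) (by positivity : 0 < u / v) (by ring)
    simp only [Real.log_one, smul_eq_mul, mul_zero, zero_add, mul_one] at h
    refine h.trans_eq (congrArg _ ?_)
    field_simp
    ring
  refine ⟨u₀, hu₀0, fun u hu huu => ?_, fun u huu => ?_⟩
  · have h := hconc u u₀ hu huu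
    rwa [hzero, div_mul_cancel₀ _ hu₀0.ne'] at h
  · have h := hconc u₀ u hu₀0 huu
    rw [hzero, div_mul_eq_mul_div, div_lt_iff₀ (hu₀0.trans huu)] at h
    exact lt_of_mul_lt_mul_left h hu₀0.le

/-- In the variable `u = 1/α` the derivative is `log (1 + p u) - u`, the function studied in
`exists_log_one_add_mul_eq`. -/
theorem hasDerivAt_logPhiSq (p : ℕ) {α : ℝ} (hα : 0 < α) :
    HasDerivAt (logPhiSq p) (Real.log (1 + p * α⁻¹) - α⁻¹) α := by
  have hpα : (0 : ℝ) < p + α := by positivity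
  have h1 := ((hasDerivAt_id α).add_const 1).mul (Real.hasDerivAt_log hα.ne')
  have h2 : HasDerivAt (fun x : ℝ => (p + x) * Real.log (p + x))
      (1 * Real.log (p + α) + (p + α) * (1 / (p + α))) α := by
    have h3 := (hasDerivAt_id α).const_add (p : ℝ)
    exact h3.mul (h3.log hpα.ne')
  have h4 := (h1.const_sub (-(p * Real.log p) - 1)).add h2
  have e : (1 + p * α⁻¹ : ℝ) = (p + α) / α := by field_simp; ring
  rw [e, Real.log_div hpα.ne' hα.ne']
  convert! h4 using 1
  simp only [id]
  field_simp
  ring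

theorem exists_forall_phi_lt {p : ℕ} (hp : 2 ≤ p) :
    ∃ α₀ : ℝ, 0 < α₀ ∧ ∀ β, 0 < β → β ≠ α₀ → phi p α₀ < phi p β := by
  obtain ⟨u₀, hu₀, hlo, hhi⟩ := exists_log_one_add_mul_eq hp
  refine ⟨u₀⁻¹, inv_pos.2 hu₀, fun β hβ hne => ?_⟩
  have hα₀ := inv_pos.2 hu₀
  rw [phi_eq_exp (by omega) hα₀, phi_eq_exp (by omega) hβ]
  have hcont : ∀ s : Set ℝ, s ⊆ Set.Ioi 0 → ContinuousOn (logPhiSq p) s := fun s hs x hx =>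
    (hasDerivAt_logPhiSq p (hs hx)).continuousAt.continuousWithinAt
  suffices logPhiSq p u₀⁻¹ < logPhiSq p β from Real.exp_lt_exp.2 (by linarith)
  rcases lt_or_gt_of_ne hne with h | h
  · refine strictAntiOn_of_deriv_neg (convex_Icc β u₀⁻¹)
      (hcont _ fun x hx => hβ.trans_le hx.1) (fun x hx => ?_) ⟨le_rfl, h.le⟩ ⟨h.le, le_rfl⟩ h
    rw [interior_Icc] at hx
    have hx0 : 0 < x := hβ.trans hx.1
    rw [(hasDerivAt_logPhiSq p hx0).deriv, sub_neg]
    exact hhi _ ((lt_inv_comm₀ hu₀ hx0).2 hx.2)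
  · refine strictMonoOn_of_deriv_pos (convex_Icc u₀⁻¹ β)
      (hcont _ fun x hx => hα₀.trans_le hx.1) (fun x hx => ?_) ⟨le_rfl, h.le⟩ ⟨h.le, le_rfl⟩ h
    rw [interior_Icc] at hx
    have hx0 : 0 < x := hα₀.trans hx.1
    rw [(hasDerivAt_logPhiSq p hx0).deriv, sub_pos]
    exact hlo _ (inv_pos.2 hx0) ((inv_lt_comm₀ hx0 hu₀).2 hx.1)

/-- The minimiser is `1/u₀` with `log (1 + p u₀) = u₀`, so `u₀` is of order `log p`; hence the test
point `α = 1 / log p`. -/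
theorem phi_inv_log_le {p : ℕ} (hp : 2 ≤ p) :
    phi p (Real.log p)⁻¹ ≤ √(Real.log p) * Real.exp (1 / 2 *
      (Real.log (Real.log p) / Real.log p + (1 + (Real.log p)⁻¹ / p) * (Real.log p)⁻¹)) := by
  have hp1 : (1 : ℝ) < p := by exact_mod_cast hp
  have hp0 : (0 : ℝ) < p := by linarith
  have hy : 0 < Real.log p := Real.log_pos hp1
  rw [phi_eq_exp (by omega) (inv_pos.2 hy), Real.sqrt_eq_rpow, Real.rpow_def_of_pos hy,
    ← Real.exp_add, logPhiSq]
  refine Real.exp_le_exp.2 ?_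
  set y := Real.log p with hydef
  have e : (p : ℝ) + y⁻¹ = p * (1 + y⁻¹ / p) := by field_simp
  have hpos : 0 < 1 + y⁻¹ / p := by positivity
  have h1 : Real.log (p + y⁻¹) ≤ y + y⁻¹ / p := by
    rw [e, Real.log_mul hp0.ne' hpos.ne', ← hydef]
    linarith [Real.log_le_sub_one_of_pos hpos]
  rw [Real.log_inv]
  have h2 : (p + y⁻¹) * Real.log (p + y⁻¹) ≤ (p + y⁻¹) * (y + y⁻¹ / p) := by gcongr
  have h3 : (p + y⁻¹) * (y + y⁻¹ / p) = p * y + y⁻¹ + 1 + y⁻¹ * (y⁻¹ / p) := by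
    field_simp
    ring
  rw [h3] at h2
  have h4 : Real.log y / y = y⁻¹ * Real.log y := by rw [div_eq_inv_mul]
  rw [h4]
  linarith

theorem exists_phi_minimizer :
    ∃ α₀ : ℕ → ℝ,
      (∀ p : ℕ, 2 ≤ p →
        0 < α₀ p ∧
        phi p (α₀ p) = (⨅ α : Set.Ioi (0 : ℝ), phi p α) ∧
        ∀ β : ℝ, 0 < β → phi p β = (⨅ α : Set.Ioi (0 : ℝ), phi p α) → β = α₀ p) ∧
      ∃ r : ℕ → ℝ, Tendsto r atTop (𝓝 0) ∧
        ∀ p : ℕ, 2 ≤ p → phi p (α₀ p) ≤ √(Real.log p) * (1 + r p) := by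
  have h : ∀ p : ℕ, ∃ α₀ : ℝ, 2 ≤ p → 0 < α₀ ∧ ∀ β, 0 < β → β ≠ α₀ → phi p α₀ < phi p β := by
    intro p
    by_cases hp : 2 ≤ p
    · obtain ⟨α₀, hα₀⟩ := exists_forall_phi_lt hp
      exact ⟨α₀, fun _ => hα₀⟩
    · exact ⟨0, fun h => absurd h hp⟩
  choose α₀ hα₀ using h
  have hmin : ∀ p, 2 ≤ p → ∀ β, 0 < β → phi p (α₀ p) ≤ phi p β := fun p hp β hβ => by
    rcases eq_or_ne β (α₀ p) with rfl | hne
    · exact le_rfl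
    · exact ((hα₀ p hp).2 β hβ hne).le
  have hne : Nonempty (Set.Ioi (0 : ℝ)) := ⟨⟨1, Set.mem_Ioi.2 one_pos⟩⟩
  have hinf : ∀ p, 2 ≤ p → phi p (α₀ p) = ⨅ α : Set.Ioi (0 : ℝ), phi p α := fun p hp =>
    le_antisymm (le_ciInf fun α => hmin p hp α α.2)
      (ciInf_le (f := fun α : Set.Ioi (0 : ℝ) => phi p α)
        ⟨0, by rintro _ ⟨α, rfl⟩; exact phi_nonneg p α.2⟩ ⟨α₀ p, (hα₀ p hp).1⟩)
  refine ⟨α₀, fun p hp => ⟨(hα₀ p hp).1, hinf p hp, fun β hβ hβe => ?_⟩, ?_⟩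
  · by_contra hne
    have := (hα₀ p hp).2 β hβ hne
    rw [hβe, ← hinf p hp] at this
    exact lt_irrefl _ this
  · refine ⟨fun p => Real.exp (1 / 2 * (Real.log (Real.log p) / Real.log p +
      (1 + (Real.log p)⁻¹ / p) * (Real.log p)⁻¹)) - 1, ?_, fun p hp => ?_⟩
    · have hinv : Tendsto (fun p : ℕ => (Real.log p)⁻¹) atTop (𝓝 0) :=
        (Real.tendsto_log_atTop.comp tendsto_natCast_atTop_atTop).inv_tendsto_atTop
      have hp : Tendsto (fun p : ℕ => (Real.log p)⁻¹ / (p : ℝ)) atTop (𝓝 0) :=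
        hinv.div_atTop tendsto_natCast_atTop_atTop
      have h := (tendsto_log_log_div_log.add ((hp.const_add 1).mul hinv)).const_mul (1 / 2 : ℝ)
      have h2 := ((Real.continuous_exp.tendsto _).comp h).sub_const 1
      simpa using h2
    · rw [add_sub_cancel]
      refine (hmin p hp _ (inv_pos.2 (Real.log_pos ?_))).trans (phi_inv_log_le hp)
      exact_mod_cast hp

end

/-! ### Application to the two models. -/

section

theorem hasDiagonalMoments_of_model {p d : ℕ} {Ω : Type*} [MeasurableSpace Ω] {μ : Measure Ω}
    [IsProbabilityMeasure μ] {B : Ω → Tensor p d} (h : ModelS B μ ∨ ModelSTilde B μ) :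
    HasDiagonalMoments B μ :=
  h.elim ModelS.hasDiagonalMoments ModelSTilde.hasDiagonalMoments

theorem momentBound_of_model {p d : ℕ} (hp : 1 ≤ p) (hd : 1 ≤ d) {Ω : Type*} [MeasurableSpace Ω]
    {μ : Measure Ω} [IsProbabilityMeasure μ] {B : Ω → Tensor p d}
    (h : ModelS B μ ∨ ModelSTilde B μ) : MomentBound p d (∫ ω, injNorm (B ω) ∂μ) :=
  (hasDiagonalMoments_of_model h).integral_injNorm_pow_le hp hd

end

end SymTensor

end

theorem theorem4p2 :
    -- the injective norms are integrable, so that the expectations below are meaningful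
    (∀ (p d : ℕ), 1 ≤ p → 1 ≤ d →
      ∀ (Ω : Type*) [MeasurableSpace Ω] (μ : Measure Ω) [IsProbabilityMeasure μ]
        (B : Ω → SymTensor.Tensor p d),
        (SymTensor.ModelS B μ ∨ SymTensor.ModelSTilde B μ) →
        Integrable (fun ω => SymTensor.injNorm (B ω)) μ) ∧
    -- `d` fixed, `p → ∞`
    (∀ d : ℕ, 1 ≤ d →
      ∀ (Ω : ℕ → Type*) [∀ p, MeasurableSpace (Ω p)] (μ : ∀ p, Measure (Ω p))
        [∀ p, IsProbabilityMeasure (μ p)] (B : ∀ p, Ω p → SymTensor.Tensor p d),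
        (∀ p, 1 ≤ p → SymTensor.ModelS (B p) (μ p) ∨ SymTensor.ModelSTilde (B p) (μ p)) →
        limsup (fun p : ℕ =>
            ((1 / √(Real.log p) * ∫ ω, SymTensor.injNorm (B p ω) ∂(μ p) : ℝ) : EReal)) atTop
          ≤ ((√(((d : ℝ) - 1) / d) : ℝ) : EReal)) ∧
    -- the rate; `p₀` depends only on `d` and `ε`
    (∀ d : ℕ, 2 ≤ d → ∀ ε : ℝ, 0 < ε → ∃ p₀ : ℕ, ∀ p : ℕ, p₀ ≤ p → 1 ≤ p →
      ∀ (Ω : Type*) [MeasurableSpace Ω] (μ : Measure Ω) [IsProbabilityMeasure μ]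
        (B : Ω → SymTensor.Tensor p d),
        (SymTensor.ModelS B μ ∨ SymTensor.ModelSTilde B μ) →
        1 / √(Real.log p) * ∫ ω, SymTensor.injNorm (B ω) ∂μ
          ≤ √(((d : ℝ) - 1) / d) *
            (1 + (1 + ε) * ((2 * (d : ℝ) - 1) / (4 * (d : ℝ) - 4)) *
              (Real.log (Real.log p) / Real.log p))) ∧
    -- `p` fixed, `d → ∞`
    (∀ p : ℕ, 1 ≤ p →
      ∀ (Ω : ℕ → Type*) [∀ d, MeasurableSpace (Ω d)] (μ : ∀ d, Measure (Ω d))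
        [∀ d, IsProbabilityMeasure (μ d)] (B : ∀ d, Ω d → SymTensor.Tensor p d),
        (∀ d, 1 ≤ d → SymTensor.ModelS (B d) (μ d) ∨ SymTensor.ModelSTilde (B d) (μ d)) →
        limsup (fun d : ℕ => ((∫ ω, SymTensor.injNorm (B d ω) ∂(μ d) : ℝ) : EReal)) atTop
          ≤ ((⨅ α : Set.Ioi (0 : ℝ), SymTensor.phi p α : ℝ) : EReal)) ∧
    -- the infimum is attained at a unique point, with the stated size as `p → ∞`
    (∃ α₀ : ℕ → ℝ,
      (∀ p : ℕ, 2 ≤ p →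
        0 < α₀ p ∧
        SymTensor.phi p (α₀ p) = (⨅ α : Set.Ioi (0 : ℝ), SymTensor.phi p α) ∧
        ∀ β : ℝ, 0 < β → SymTensor.phi p β = (⨅ α : Set.Ioi (0 : ℝ), SymTensor.phi p α) →
          β = α₀ p) ∧
      ∃ r : ℕ → ℝ, Tendsto r atTop (𝓝 0) ∧
        ∀ p : ℕ, 2 ≤ p → SymTensor.phi p (α₀ p) ≤ √(Real.log p) * (1 + r p)) := by
  refine ⟨?_, ?_, ?_, ?_, SymTensor.exists_phi_minimizer⟩
  · intro p d _ hd Ω _ μ _ B hB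
    exact (SymTensor.hasDiagonalMoments_of_model hB).integrable_injNorm hd
  · intro d hd Ω _ μ _ B hB
    exact SymTensor.limsup_div_sqrt_log_le hd fun p hp =>
      SymTensor.momentBound_of_model hp hd (hB p hp)
  · intro d hd ε hε
    obtain ⟨p₀, hp₀⟩ := SymTensor.exists_rate hd hε
    exact ⟨p₀, fun p hp hp1 Ω _ μ _ B hB =>
      hp₀ p hp hp1 _ (SymTensor.momentBound_of_model hp1 (by omega) hB)⟩
  · intro p hp Ω _ μ _ B hB
    exact SymTensor.limsup_le_iInf_phi hp fun d hd =>
      SymTensor.momentBound_of_model hp hd (hB d hd)
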